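/- Let $\Lambda$ be a discrete group acting by homeomorphisms on a contractible (Hausdorff) CW complex $Y$. Suppose that the action is proper, i.e. for all compact subsets $A, B \subseteq Y$ the set $\{\lambda \in \Lambda : \lambda A \cap B \neq \emptyset\}$ is finite, and cellular, i.e. every $\lambda \in \Lambda$ maps each open $n$-cell of $Y$ onto an open $n$-cell of $Y$, for every $n \ge 0$. Then $$\mathrm{cd}_{\mathbf{Q}} \Lambda \le \dim Y,$$ where $\mathrm{cd}_{\mathbf{Q}} \Lambda = \sup\{\, n \ge 0 : H^n(\Lambda, A) \neq 0 \text{ for some } \mathbf{Q}\Lambda\text{-module } A \,\}$ is the rational cohomological dimension of $\Lambda$ and $\dim Y$ is the supremum of the dimensions of the cells of $Y$ (both in $\{0, 1, 2, \dots, \infty\}$). -/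

import Mathlib

universe u v

/-- The cohomological dimension of a group `G` over a commutative ring `k`, in `ℕ∞`: the supremum
of all `n` such that `Hⁿ(G, A) ≠ 0` for some `k`-linear representation `A` of `G`
(equivalently, some `k[G]`-module `A`). -/
noncomputable def cohomologicalDimension (k G : Type u) [CommRing k] [Group G] : ℕ∞ :=
  ⨆ n ∈ {n : ℕ | ∃ A : Rep.{u} k G, Nontrivial (groupCohomology A n)}, (n : ℕ∞)

/-- The rational cohomological dimension `cd_ℚ G`. Mathlib's group cohomology wants the group and
the coefficient ring in one universe, so `ℚ` is lifted to the universe of `G`. -/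
noncomputable def rationalCohomologicalDimension (G : Type u) [Group G] : ℕ∞ :=
  cohomologicalDimension (ULift.{u} ℚ) G

/-- The dimension, in `ℕ∞`, of a (nonempty) space `Y` with a CW structure: the supremum of the
dimensions of its cells. -/
noncomputable def cwDimension (Y : Type v) [TopologicalSpace Y]
    [Topology.CWComplex (Set.univ : Set Y)] : ℕ∞ :=
  ⨆ n ∈ {n : ℕ | Nonempty (Topology.CWComplex.cell (Set.univ : Set Y) n)}, (n : ℕ∞)

/-- The action of `G` on the CW complex `Y` is cellular: every group element carries each open
`n`-cell onto an open `n`-cell. An element that maps a cell to itself is not required to fix it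
pointwise, nor to preserve its orientation. -/
def IsCellularAction (G : Type u) (Y : Type v) [Group G] [TopologicalSpace Y]
    [Topology.CWComplex (Set.univ : Set Y)] [MulAction G Y] : Prop :=
  ∀ (g : G) (n : ℕ) (e : Topology.CWComplex.cell (Set.univ : Set Y) n),
    ∃ e' : Topology.CWComplex.cell (Set.univ : Set Y) n,
      (fun y : Y => g • y) '' Topology.CWComplex.openCell (C := (Set.univ : Set Y)) n e =
        Topology.CWComplex.openCell (C := (Set.univ : Set Y)) n e'

/-!
Only the case of finite `d = dim Y` has content. Cellular homology is not used; instead, the ordered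
chains of `Λ`, which form the standard resolution of the trivial module, are shown to have an
equivariant contraction in degrees above `d`. The contraction is the cone homotopy from the identity
to an equivariant chain endomorphism over the augmentation that vanishes in those degrees
(`TupleChain.exists_equivariant_contraction`), and it makes the cohomology vanish there
(`subsingleton_groupCohomology_of_contraction`).

The endomorphism is a cup product of `1`-cocycles. Suppose that `p 0, …, p d` are equivariant maps
from `Y` to `ℚ[Λ]` of augmentation `1`, and that `Y` has an invariant open cover `W` such that on
each member of `W` one of the `p j` is constant. Then

* ordered chains of `Λ` are free over `Λ`, so they map equivariantly to the singular chains of `Y`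
  subordinate to `W`, which are exact by subdivision, because `Y` is contractible
  (`SingularChain.exists_equivariant_lift`, `SingularChain.exists_subordinate_filling`);
* a singular simplex is sent to the tuple of its vertices, and a tuple `(y₀, …, yₙ)` to the join of
  `p n y₀`, `p (n - 1) y₁ - p (n - 1) y₀`, …, `p 0 yₙ - p 0 yₙ₋₁` (`TupleChain.cupMap`). For `n > d`
  each of `p 0, …, p d` contributes such a difference, and on a simplex subordinate to `W` one of
  these differences is zero.

The cover consists of disjoint neighbourhoods of the open `j`-cells, for each `j ≤ d`, which are
permuted by `Λ` (`exists_skeletal_neighbourhoods`). As the stabilizer of a cell is finite and its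
order is invertible in `ℚ`, the neighbourhoods of the `j`-cells carry an equivariant locally
constant map to `ℚ[Λ]`; it is defined on the rest of `Y` by averaging over the finite stabilizers of
points (`exists_equivariant_average`, `exists_equivariant_function`). No continuity of `p j` outside
these neighbourhoods is needed.
-/

/-! ### Ordered chains and small fillings -/

section TupleChains

/-- Ordered chains: formal `k`-linear combinations of `n`-tuples of points of `X`. The index `n` is
the number of vertices, so that `n = 0` is the augmentation term. -/
abbrev TupleChain (k : Type*) (X : Type*) [CommRing k] (n : ℕ) := (Fin n → X) →₀ k

namespace TupleChain

variable {k : Type*} {X Y Z : Type*} [CommRing k]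

theorem hom_ext {α M : Type*} [AddCommGroup M] [Module k M] {f g : (α →₀ k) →ₗ[k] M}
    (h : ∀ a, f (Finsupp.single a 1) = g (Finsupp.single a 1)) : f = g :=
  Finsupp.lhom_ext' fun a => LinearMap.ext_ring (h a)

theorem map_mem_of_mem_supported {α M : Type*} [AddCommGroup M] [Module k M]
    (f : (α →₀ k) →ₗ[k] M) (p : Submodule k M) {s : Set α}
    (h : ∀ a ∈ s, f (Finsupp.single a 1) ∈ p) {z : α →₀ k}
    (hz : z ∈ Finsupp.supported k k s) : f z ∈ p := by
  rw [Finsupp.supported_eq_span_single] at hz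
  have : Submodule.span k ((fun i => Finsupp.single i (1 : k)) '' s) ≤ p.comap f := by
    rw [Submodule.span_le]
    rintro _ ⟨a, ha, rfl⟩
    exact h a ha
  exact this hz

/-- The alternating sum of the faces of a tuple. -/
noncomputable def bd (n : ℕ) : TupleChain k X (n + 1) →ₗ[k] TupleChain k X n :=
  Finsupp.linearCombination k fun t =>
    ∑ i : Fin (n + 1), (-1 : k) ^ (i : ℕ) • Finsupp.single (t ∘ i.succAbove) 1

/-- Prepending a fixed vertex. -/
noncomputable def cone (x : X) (n : ℕ) : TupleChain k X n →ₗ[k] TupleChain k X (n + 1) :=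
  Finsupp.lmapDomain k k fun t => (Fin.cons x t : Fin (n + 1) → X)

/-- The chain map induced by a map of vertex sets. -/
noncomputable def push (f : X → Y) (n : ℕ) : TupleChain k X n →ₗ[k] TupleChain k Y n :=
  Finsupp.lmapDomain k k fun t => f ∘ t

theorem bd_single (n : ℕ) (t : Fin (n + 1) → X) :
    bd n (Finsupp.single t (1 : k)) =
      ∑ i : Fin (n + 1), (-1 : k) ^ (i : ℕ) • Finsupp.single (t ∘ i.succAbove) 1 := by
  simp [bd]

@[simp] theorem cone_single (x : X) (n : ℕ) (t : Fin n → X) (a : k) :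
    cone x n (Finsupp.single t a) = Finsupp.single (Fin.cons x t : Fin (n + 1) → X) a := by
  simp [cone, Finsupp.mapDomain_single]

@[simp] theorem push_single (f : X → Y) (n : ℕ) (t : Fin n → X) (a : k) :
    push f n (Finsupp.single t a) = Finsupp.single (f ∘ t) a := by
  simp [push, Finsupp.mapDomain_single]

theorem single_eq_cone (n : ℕ) (t : Fin (n + 1) → X) :
    Finsupp.single t (1 : k) = cone (t 0) n (Finsupp.single (Fin.tail t) 1) := by
  simp

theorem bd_cone_zero (x : X) (z : TupleChain k X 0) : bd 0 (cone x 0 z) = z := by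
  have : bd 0 ∘ₗ cone x 0 = (LinearMap.id : TupleChain k X 0 →ₗ[k] _) := by
    refine hom_ext fun t => ?_
    simp only [LinearMap.comp_apply, cone_single, bd_single, LinearMap.id_apply]
    rw [Fin.sum_univ_one]
    simp [Subsingleton.elim ((Fin.cons x t : Fin 1 → X) ∘ Fin.succ) t]
  exact LinearMap.congr_fun this z

theorem bd_cone (x : X) (n : ℕ) (z : TupleChain k X (n + 1)) :
    bd (n + 1) (cone x (n + 1) z) = z - cone x n (bd n z) := by
  have : bd (n + 1) ∘ₗ cone x (n + 1) =
      (LinearMap.id : TupleChain k X (n + 1) →ₗ[k] _) - cone x n ∘ₗ bd n := by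
    refine hom_ext fun t => ?_
    simp only [LinearMap.comp_apply, cone_single, bd_single, LinearMap.id_apply,
      LinearMap.sub_apply, map_sum, map_smul]
    rw [Fin.sum_univ_succ]
    have h0 : (Fin.cons x t : Fin (n + 2) → X) ∘ Fin.succAbove 0 = t := by
      ext i; simp
    have h1 (i : Fin (n + 1)) : (Fin.cons x t : Fin (n + 2) → X) ∘ Fin.succAbove i.succ =
        Fin.cons x (t ∘ i.succAbove) := by
      ext j
      refine Fin.cases ?_ (fun j => ?_) j <;> simp
    simp only [h0, h1, Fin.val_zero, pow_zero, one_smul, Fin.val_succ, pow_succ, mul_neg, mul_one,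
      neg_smul, Finset.sum_neg_distrib, sub_eq_add_neg]
  exact LinearMap.congr_fun this z

theorem bd_bd (n : ℕ) (z : TupleChain k X (n + 2)) : bd n (bd (n + 1) z) = 0 := by
  induction n with
  | zero =>
    have : bd 0 ∘ₗ bd 1 = (0 : TupleChain k X 2 →ₗ[k] _) := by
      refine hom_ext fun t => ?_
      rw [single_eq_cone, LinearMap.comp_apply, bd_cone, map_sub, bd_cone_zero]
      simp
    exact LinearMap.congr_fun this z
  | succ n ih =>
    have : bd (n + 1) ∘ₗ bd (n + 2) = (0 : TupleChain k X (n + 3) →ₗ[k] _) := by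
      refine hom_ext fun t => ?_
      rw [single_eq_cone, LinearMap.comp_apply, bd_cone, map_sub, bd_cone, ih]
      simp
    exact LinearMap.congr_fun this z

theorem bd_push (f : X → Y) (n : ℕ) (z : TupleChain k X (n + 1)) :
    bd n (push f (n + 1) z) = push f n (bd n z) := by
  have : bd n ∘ₗ push f (n + 1) = (push f n ∘ₗ bd n : TupleChain k X (n + 1) →ₗ[k] _) := by
    refine hom_ext fun t => ?_
    simp [bd_single, Function.comp_assoc]
  exact LinearMap.congr_fun this z

theorem push_comp (g : Y → Z) (f : X → Y) (n : ℕ) (z : TupleChain k X n) :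
    push g n (push f n z) = push (g ∘ f) n z := by
  have : push g n ∘ₗ push f n = (push (g ∘ f) n : TupleChain k X n →ₗ[k] _) := by
    refine hom_ext fun t => ?_
    simp [Function.comp_assoc]
  exact LinearMap.congr_fun this z

theorem push_cone (f : X → Y) (x : X) (n : ℕ) (z : TupleChain k X n) :
    push f (n + 1) (cone x n z) = cone (f x) n (push f n z) := by
  have : push f (n + 1) ∘ₗ cone x n = (cone (f x) n ∘ₗ push f n : TupleChain k X n →ₗ[k] _) := by
    refine hom_ext fun t => ?_
    simp only [LinearMap.comp_apply, cone_single, push_single]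
    congr 1
    ext i
    refine Fin.cases ?_ (fun j => ?_) i <;> simp
  exact LinearMap.congr_fun this z

/-- The prism operator of a self-map `m`: the chain homotopy from the identity to `push m`, which
sends `(x₀, …)` to the alternating sum of the tuples `(x₀, …, xᵢ, m xᵢ, m xᵢ₊₁, …)`. -/
noncomputable def prism (m : X → X) : ∀ n, TupleChain k X n →ₗ[k] TupleChain k X (n + 1)
  | 0 => 0
  | n + 1 => Finsupp.linearCombination k fun t =>
      cone (t 0) (n + 1) (cone (m (t 0)) n (push m n (Finsupp.single (Fin.tail t) 1)) -
        prism m n (Finsupp.single (Fin.tail t) 1))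

theorem prism_cone (m : X → X) (x : X) (n : ℕ) (z : TupleChain k X n) :
    prism m (n + 1) (cone x n z) =
      cone x (n + 1) (cone (m x) n (push m n z) - prism m n z) := by
  have : prism m (n + 1) ∘ₗ cone x n =
      (cone x (n + 1) ∘ₗ (cone (m x) n ∘ₗ push m n - prism m n) :
        TupleChain k X n →ₗ[k] _) := by
    refine hom_ext fun t => ?_
    simp [prism]
  exact LinearMap.congr_fun this z

theorem bd_prism (m : X → X) (n : ℕ) (z : TupleChain k X (n + 1)) :
    bd (n + 1) (prism m (n + 1) z) + prism m n (bd n z) = push m (n + 1) z - z := by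
  induction n with
  | zero =>
    have : bd 1 ∘ₗ prism m 1 + prism m 0 ∘ₗ bd 0 =
        (push m 1 - LinearMap.id : TupleChain k X 1 →ₗ[k] _) := by
      refine hom_ext fun t => ?_
      rw [single_eq_cone]
      simp only [LinearMap.comp_apply, LinearMap.add_apply, LinearMap.sub_apply,
        LinearMap.id_apply, prism_cone, bd_cone, push_cone, map_sub, bd_cone_zero]
      simp only [prism, LinearMap.zero_apply, map_zero, sub_zero, add_zero]
      have : push m 0 (Finsupp.single (Fin.tail t) (1 : k)) = Finsupp.single (Fin.tail t) 1 := by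
        rw [push_single, Subsingleton.elim (m ∘ Fin.tail t) (Fin.tail t)]
      rw [this]
    exact LinearMap.congr_fun this z
  | succ n ih =>
    have : bd (n + 2) ∘ₗ prism m (n + 2) + prism m (n + 1) ∘ₗ bd (n + 1) =
        (push m (n + 2) - LinearMap.id : TupleChain k X (n + 2) →ₗ[k] _) := by
      refine hom_ext fun t => ?_
      rw [single_eq_cone]
      simp only [LinearMap.comp_apply, LinearMap.add_apply, LinearMap.sub_apply,
        LinearMap.id_apply, prism_cone, bd_cone, push_cone, map_sub, bd_push]
      have h := ih (Finsupp.single (Fin.tail t) 1)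
      have h' := congrArg (cone (t 0) (n + 1)) h
      rw [map_add, map_sub] at h'
      rw [← sub_eq_zero] at h' ⊢
      rw [← h']
      abel
    exact LinearMap.congr_fun this z

theorem prism_mem (m : X → X) (n : ℕ) (t : Fin n → X) :
    prism m n (Finsupp.single t (1 : k)) ∈
      Finsupp.supported k k {s : Fin (n + 1) → X | ∀ i, ∃ j, s i = t j ∨ s i = m (t j)} := by
  induction n with
  | zero => simp [prism]
  | succ n ih =>
    rw [single_eq_cone, prism_cone, map_sub]
    refine Submodule.sub_mem _ ?_ ?_
    · simp only [push_single, cone_single]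
      refine Finsupp.single_mem_supported _ _ fun i => ?_
      refine Fin.cases ⟨0, Or.inl rfl⟩ (fun i => ?_) i
      refine Fin.cases ⟨0, Or.inr rfl⟩ (fun i => ?_) i
      exact ⟨i.succ, Or.inr rfl⟩
    · refine map_mem_of_mem_supported _ _ (fun s hs => ?_) (ih (Fin.tail t))
      rw [cone_single]
      refine Finsupp.single_mem_supported _ _ fun i => ?_
      refine Fin.cases ⟨0, Or.inl rfl⟩ (fun i => ?_) i
      obtain ⟨j, hj⟩ := hs i
      exact ⟨j.succ, hj⟩

/-- Tuples of points of a metric space whose vertices are pairwise at distance less than `ε`. -/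
def smallTuples (X : Type*) [Dist X] (ε : ℝ) (n : ℕ) : Set (Fin n → X) :=
  {t | ∀ i j, dist (t i) (t j) < ε}

/-- If iterating a contraction `m` towards `c` moves the vertices of a cycle of small tuples by so
little that the prism operator keeps tuples small, then the cycle bounds a chain of small tuples:
push it forward until all its vertices are near `c`, and take the cone there. -/
theorem exists_small_filling_of_contraction [PseudoMetricSpace X] (c : X) (m : X → X) (s : ℝ)
    (hs : 0 < s) (hm : ∀ x y, dist (m x) (m y) = s * dist x y) (hmc : m c = c) (hs1 : s ≤ 1)
    (ε : ℝ) (n N : ℕ) (R : ℝ) (hR : s ^ N * R < ε / 2) (z : TupleChain k X (n + 1))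
    (hz : z ∈ Finsupp.supported k k {t : Fin (n + 1) → X | (∀ i j, dist (t i) (t j) < ε) ∧
      (∀ i j, dist (t i) (m (t j)) < ε) ∧ ∀ i, dist (t i) c ≤ R})
    (hbd : bd n z = 0) :
    ∃ w ∈ Finsupp.supported k k (smallTuples X ε (n + 2)), bd (n + 1) w = z := by
  induction N generalizing R z with
  | zero =>
    refine ⟨cone c (n + 1) z, ?_, by rw [bd_cone, hbd, map_zero, sub_zero]⟩
    refine map_mem_of_mem_supported _ _ (fun t ht => ?_) hz
    rw [cone_single]
    refine Finsupp.single_mem_supported _ _ ?_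
    have hRε : R < ε / 2 := by simpa using hR
    have hR0 : 0 ≤ R := dist_nonneg.trans (ht.2.2 0)
    intro i j
    refine Fin.cases ?_ (fun i => ?_) i <;> refine Fin.cases ?_ (fun j => ?_) j
    · simp; linarith
    · have := ht.2.2 j
      simp only [Fin.cons_zero, Fin.cons_succ]
      rw [dist_comm]; linarith
    · have := ht.2.2 i
      simp only [Fin.cons_zero, Fin.cons_succ]
      linarith
    · exact ht.1 i j
  | succ N ih =>
    have hle (x y : X) : dist (m x) (m y) ≤ dist x y := by
      rw [hm]; exact mul_le_of_le_one_left dist_nonneg hs1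
    obtain ⟨w, hw, hwz⟩ := ih (s * R) (by rw [← mul_assoc, ← pow_succ]; exact hR)
      (push m (n + 1) z)
      (by
        refine map_mem_of_mem_supported _ _ (fun t ht => ?_) hz
        rw [push_single]
        refine Finsupp.single_mem_supported _ _ ⟨fun i j => ?_, fun i j => ?_, fun i => ?_⟩
        · exact (hle _ _).trans_lt (ht.1 i j)
        · exact (hle _ _).trans_lt (ht.2.1 i j)
        · have h := hm (t i) c
          rw [hmc] at h
          simp only [Function.comp_apply, h]
          exact mul_le_mul_of_nonneg_left (ht.2.2 i) hs.le)
      (by rw [bd_push, hbd, map_zero])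
    refine ⟨w - prism m (n + 1) z, Submodule.sub_mem _ hw ?_, ?_⟩
    · refine map_mem_of_mem_supported _ _ (fun t ht => ?_) hz
      refine Finsupp.supported_mono ?_ (prism_mem m (n + 1) t)
      intro r hr i j
      obtain ⟨a, ha | ha⟩ := hr i <;> obtain ⟨b, hb | hb⟩ := hr j <;> rw [ha, hb]
      · exact ht.1 a b
      · exact ht.2.1 a b
      · rw [dist_comm]; exact ht.2.1 b a
      · exact (hle _ _).trans_lt (ht.1 a b)
    · have h := bd_prism m n z
      rw [hbd, map_zero, add_zero] at h
      rw [map_sub, hwz, h]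
      abel

/-- In a bounded convex set, every cycle of `ε`-small tuples bounds a chain of `ε`-small tuples. -/
theorem exists_small_filling {E : Type*} [NormedAddCommGroup E] [NormedSpace ℝ E] {K : Set E}
    (hK : Convex ℝ K) (hb : Bornology.IsBounded K) (c : K) {ε : ℝ} (hε : 0 < ε) (n : ℕ)
    (z : TupleChain k K (n + 1)) (hz : z ∈ Finsupp.supported k k (smallTuples K ε (n + 1)))
    (hbd : bd n z = 0) :
    ∃ w ∈ Finsupp.supported k k (smallTuples K ε (n + 2)), bd (n + 1) w = z := by
  obtain ⟨R, hR⟩ := (Metric.isBounded_iff_subset_closedBall (c : E)).1 hb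
  have hev : ∀ᶠ s in nhdsWithin (1 : ℝ) (Set.Iio 1), 0 < s ∧ s < 1 ∧
      ∀ t ∈ z.support, ∀ i j : Fin (n + 1),
        dist (t i : E) ((c : E) + s • ((t j : E) - c)) < ε := by
    refine Filter.Eventually.and ?_ (Filter.Eventually.and self_mem_nhdsWithin ?_)
    · exact (lt_mem_nhds zero_lt_one).filter_mono nhdsWithin_le_nhds
    · refine Filter.Eventually.filter_mono nhdsWithin_le_nhds ?_
      rw [Filter.eventually_all_finset]
      intro t ht
      rw [Filter.eventually_all]
      intro i
      rw [Filter.eventually_all]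
      intro j
      have hc : Continuous fun s : ℝ => dist (t i : E) ((c : E) + s • ((t j : E) - c)) := by
        fun_prop
      refine hc.continuousAt.eventually_lt continuousAt_const ?_
      have := hz ht i j
      simpa [Subtype.dist_eq] using this
  obtain ⟨s, hs0, hs1, hs⟩ := hev.exists
  let m : K → K := fun x => ⟨(c : E) + s • ((x : E) - c), by
    have := hK c.2 x.2 (sub_nonneg.2 hs1.le) hs0.le (by ring)
    convert this using 1
    module⟩
  obtain ⟨N, hN⟩ : ∃ N : ℕ, s ^ N * R < ε / 2 := by
    have := (tendsto_pow_atTop_nhds_zero_of_lt_one hs0.le hs1).mul_const R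
    rw [zero_mul] at this
    exact (this.eventually (gt_mem_nhds (half_pos hε))).exists
  refine exists_small_filling_of_contraction c m s hs0 (fun x y => ?_) ?_ hs1.le ε n N R hN z ?_ hbd
  · simp only [m, Subtype.dist_eq, dist_add_left]
    rw [dist_smul₀, dist_sub_right, Real.norm_of_nonneg hs0.le]
  · ext; simp [m]
  · intro t ht
    exact ⟨hz ht, fun i j => hs t ht i j, fun i => hR (t i).2⟩

end TupleChain

end TupleChains

/-! ### Singular chains and subdivision -/

section SingularChains

/-- The standard simplex on `n` vertices (of dimension `n - 1`, and empty for `n = 0`). -/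
abbrev Simplex (n : ℕ) := ↥(stdSimplex ℝ (Fin n))

namespace Simplex

/-- The vertices of the standard simplex. -/
noncomputable def vertex {n : ℕ} (i : Fin n) : Simplex n :=
  ⟨Pi.single i 1, single_mem_stdSimplex ℝ i⟩

/-- The affine map between standard simplices with prescribed values on the vertices. -/
noncomputable def affine {n m : ℕ} (t : Fin n → Simplex m) : C(Simplex n, Simplex m) where
  toFun w := ⟨fun j => ∑ i, w.1 i * (t i).1 j,
    fun j => Finset.sum_nonneg fun i _ => mul_nonneg (w.2.1 i) ((t i).2.1 j), by
      rw [Finset.sum_comm]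
      simp_rw [← Finset.mul_sum, (t _).2.2, mul_one]
      exact w.2.2⟩
  continuous_toFun := by
    refine Continuous.subtype_mk (continuous_pi fun j => continuous_finsetSum _ fun i _ => ?_) _
    exact ((continuous_apply i).comp continuous_subtype_val).mul continuous_const

theorem affine_apply {n m : ℕ} (t : Fin n → Simplex m) (w : Simplex n) (j : Fin m) :
    (affine t w).1 j = ∑ i, w.1 i * (t i).1 j := rfl

theorem affine_vertex {n m : ℕ} (t : Fin n → Simplex m) (i : Fin n) :
    affine t (vertex i) = t i := by
  apply Subtype.ext
  funext j
  rw [affine_apply, Finset.sum_eq_single i]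
  · simp [vertex]
  · intro b _ hb; simp [vertex, hb]
  · simp

theorem affine_vertex_eq_id (n : ℕ) : affine (vertex : Fin n → Simplex n) = ContinuousMap.id _ := by
  ext w : 1
  apply Subtype.ext
  funext j
  rw [affine_apply, Finset.sum_eq_single j]
  · simp [vertex]
  · intro b _ hb; simp [vertex, hb.symm]
  · simp

theorem affine_comp {l m n : ℕ} (s : Fin m → Simplex n) (t : Fin l → Simplex m) :
    (affine s).comp (affine t) = affine (affine s ∘ t) := by
  ext w : 1
  apply Subtype.ext
  funext j
  simp only [ContinuousMap.comp_apply, affine_apply, Function.comp_apply, Finset.sum_mul,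
    Finset.mul_sum]
  rw [Finset.sum_comm]
  simp only [mul_assoc]

theorem affine_comp_vertex {n m : ℕ} (t : Fin n → Simplex m) : affine t ∘ vertex = t :=
  funext fun i => affine_vertex t i

theorem affine_mem_ball {n m : ℕ} (t : Fin n → Simplex m) (x : Simplex m) (ε : ℝ)
    (h : ∀ i, dist (t i) x < ε) (w : Simplex n) : dist (affine t w) x < ε := by
  have hc := (convex_ball (x : Fin m → ℝ) ε).sum_mem (t := Finset.univ) (w := w.1)
    (z := fun i => (t i : Fin m → ℝ)) (fun i _ => w.2.1 i) w.2.2 (fun i _ => h i)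
  have he : (affine t w : Fin m → ℝ) = ∑ i, w.1 i • (t i : Fin m → ℝ) := by
    funext j
    rw [Finset.sum_apply]
    rfl
  rw [← he] at hc
  exact hc

/-- The inclusion of the face opposite to the `i`-th vertex. -/
noncomputable def face {n : ℕ} (i : Fin (n + 1)) : C(Simplex n, Simplex (n + 1)) :=
  affine (vertex ∘ i.succAbove)

theorem face_apply_self {n : ℕ} (i : Fin (n + 1)) (w : Simplex n) : (face i w).1 i = 0 := by
  rw [face, affine_apply]
  refine Finset.sum_eq_zero fun j _ => ?_
  simp [vertex, (Fin.succAbove_ne i j).symm]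

theorem face_apply_succAbove {n : ℕ} (i : Fin (n + 1)) (w : Simplex n) (j : Fin n) :
    (face i w).1 (i.succAbove j) = w.1 j := by
  rw [face, affine_apply, Finset.sum_eq_single j]
  · simp [vertex]
  · intro b _ hb
    simp [vertex, hb.symm]
  · simp

theorem dist_face_le {n : ℕ} (i : Fin (n + 1)) (w w' : Simplex n) :
    dist (face i w) (face i w') ≤ dist w w' := by
  rw [Subtype.dist_eq, dist_pi_le_iff dist_nonneg]
  intro j
  rcases Fin.eq_self_or_eq_succAbove i j with rfl | ⟨j, rfl⟩
  · rw [face_apply_self, face_apply_self, dist_self]; exact dist_nonneg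
  · rw [face_apply_succAbove, face_apply_succAbove]
    exact dist_le_pi_dist (w : Fin n → ℝ) w' j

end Simplex

open Simplex TupleChain

/-- Singular chains of `Y`, indexed by the number of vertices; the augmentation term is spanned by
the empty simplex. -/
abbrev SingularChain (k : Type*) (Y : Type*) [CommRing k] [TopologicalSpace Y] (n : ℕ) :=
  C(Simplex n, Y) →₀ k

namespace SingularChain

variable {k : Type*} {Y : Type*} [CommRing k] [TopologicalSpace Y]

/-- The singular boundary. -/
noncomputable def bd (n : ℕ) : SingularChain k Y (n + 1) →ₗ[k] SingularChain k Y n :=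
  Finsupp.linearCombination k fun σ =>
    ∑ i : Fin (n + 1), (-1 : k) ^ (i : ℕ) • Finsupp.single (σ.comp (face i)) 1

theorem bd_single (n : ℕ) (σ : C(Simplex (n + 1), Y)) :
    bd n (Finsupp.single σ (1 : k)) =
      ∑ i : Fin (n + 1), (-1 : k) ^ (i : ℕ) • Finsupp.single (σ.comp (face i)) 1 := by
  simp [bd]

/-- The affine singular simplices in a singular simplex `σ`. -/
noncomputable def along {m : ℕ} (σ : C(Simplex m, Y)) (n : ℕ) :
    TupleChain k (Simplex m) n →ₗ[k] SingularChain k Y n :=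
  Finsupp.lmapDomain k k fun t => σ.comp (affine t)

@[simp] theorem along_single {m : ℕ} (σ : C(Simplex m, Y)) (n : ℕ) (t : Fin n → Simplex m) (a : k) :
    along σ n (Finsupp.single t a) = Finsupp.single (σ.comp (affine t)) a := by
  simp [along, Finsupp.mapDomain_single]

theorem bd_along {m : ℕ} (σ : C(Simplex m, Y)) (n : ℕ) (z : TupleChain k (Simplex m) (n + 1)) :
    bd n (along σ (n + 1) z) = along σ n (TupleChain.bd n z) := by
  have : bd n ∘ₗ along σ (n + 1) =
      (along σ n ∘ₗ TupleChain.bd n : TupleChain k (Simplex m) (n + 1) →ₗ[k] _) := by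
    refine hom_ext fun t => ?_
    simp only [LinearMap.comp_apply, along_single, bd_single, TupleChain.bd_single, map_sum,
      map_smul, face, ContinuousMap.comp_assoc, affine_comp]
    simp only [← Function.comp_assoc, affine_comp_vertex]
  exact LinearMap.congr_fun this z

theorem along_comp_affine {l m : ℕ} (σ : C(Simplex m, Y)) (s : Fin l → Simplex m) (n : ℕ)
    (z : TupleChain k (Simplex l) n) :
    along (σ.comp (affine s)) n z = along σ n (push (affine s) n z) := by
  have : along (σ.comp (affine s)) n =
      (along σ n ∘ₗ push (affine s) n : TupleChain k (Simplex l) n →ₗ[k] _) := by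
    refine hom_ext fun t => ?_
    simp [ContinuousMap.comp_assoc, affine_comp]
  exact LinearMap.congr_fun this z

/-- The natural operator on tuples determined by a model chain `a` in the standard simplex. -/
noncomputable def spreadTuple {n N : ℕ} (a : TupleChain k (Simplex n) N) (m : ℕ) :
    TupleChain k (Simplex m) n →ₗ[k] TupleChain k (Simplex m) N :=
  Finsupp.linearCombination k fun t => push (affine t) N a

/-- The natural operator on singular chains determined by a model chain `a` in the standard
simplex. -/
noncomputable def spread {n N : ℕ} (a : TupleChain k (Simplex n) N) :
    SingularChain k Y n →ₗ[k] SingularChain k Y N :=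
  Finsupp.linearCombination k fun σ => along σ N a

@[simp] theorem spreadTuple_single {n N : ℕ} (a : TupleChain k (Simplex n) N) (m : ℕ)
    (t : Fin n → Simplex m) :
    spreadTuple a m (Finsupp.single t 1) = push (affine t) N a := by
  simp [spreadTuple]

@[simp] theorem spread_single {n N : ℕ} (a : TupleChain k (Simplex n) N) (σ : C(Simplex n, Y)) :
    spread a (Finsupp.single σ 1) = along σ N a := by
  simp [spread]

theorem spread_along {n N m : ℕ} (a : TupleChain k (Simplex n) N) (σ : C(Simplex m, Y))
    (z : TupleChain k (Simplex m) n) :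
    spread a (along σ n z) = along σ N (spreadTuple a m z) := by
  have : spread a ∘ₗ along σ n = along σ N ∘ₗ spreadTuple a m := by
    refine hom_ext fun t => ?_
    simp [along_comp_affine]
  exact LinearMap.congr_fun this z

theorem push_spreadTuple {n N l m : ℕ} (a : TupleChain k (Simplex n) N) (s : Fin l → Simplex m)
    (z : TupleChain k (Simplex l) n) :
    push (affine s) N (spreadTuple a l z) = spreadTuple a m (push (affine s) n z) := by
  have : push (affine s) N ∘ₗ spreadTuple a l = spreadTuple a m ∘ₗ push (affine s) n := by
    refine hom_ext fun t => ?_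
    simp only [LinearMap.comp_apply, spreadTuple_single, push_single, push_comp, ← affine_comp]
    rfl
  exact LinearMap.congr_fun this z

/-- The fundamental tuple of the standard simplex. -/
noncomputable def fundamental (k : Type*) [CommRing k] (n : ℕ) : TupleChain k (Simplex n) n :=
  Finsupp.single vertex 1

theorem along_fundamental {n : ℕ} (σ : C(Simplex n, Y)) :
    along σ n (fundamental k n) = Finsupp.single σ 1 := by
  simp [fundamental, affine_vertex_eq_id]

theorem push_fundamental {n m : ℕ} (t : Fin n → Simplex m) :
    push (affine t) n (fundamental k n) = Finsupp.single t 1 := by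
  simp [fundamental, affine_comp_vertex]

theorem spreadTuple_bd_single {n N m : ℕ} (a : TupleChain k (Simplex n) N)
    (t : Fin (n + 1) → Simplex m) :
    spreadTuple a m (TupleChain.bd n (Finsupp.single t 1)) =
      push (affine t) N (spreadTuple a (n + 1) (TupleChain.bd n (fundamental k (n + 1)))) := by
  rw [push_spreadTuple, ← bd_push, push_fundamental]

theorem spread_bd_single {n N : ℕ} (a : TupleChain k (Simplex n) N) (σ : C(Simplex (n + 1), Y)) :
    spread a (bd n (Finsupp.single σ 1)) =
      along σ N (spreadTuple a (n + 1) (TupleChain.bd n (fundamental k (n + 1)))) := by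
  rw [← spread_along, ← bd_along, along_fundamental]

end SingularChain

namespace TupleChain
variable {k : Type*} {X : Type*} [CommRing k]

/-- The cycles of the augmented complex of ordered chains; in length `0` every chain is a cycle. -/
def IsCycle : ∀ n, TupleChain k X n → Prop
  | 0, _ => True
  | n + 1, z => bd n z = 0

theorem isCycle_bd (n : ℕ) (z : TupleChain k X (n + 1)) : IsCycle n (bd n z) := by
  cases n with
  | zero => trivial
  | succ n => exact bd_bd n z

theorem bd_cone_of_isCycle (x : X) (n : ℕ) (z : TupleChain k X n) (hz : IsCycle n z) :
    bd n (cone x n z) = z := by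
  cases n with
  | zero => exact bd_cone_zero x z
  | succ n => rw [bd_cone, show bd n z = 0 from hz, map_zero, sub_zero]

theorem exists_small_filling_of_isCycle {E : Type*} [NormedAddCommGroup E] [NormedSpace ℝ E]
    {K : Set E} (hK : Convex ℝ K) (hb : Bornology.IsBounded K) (c : K) {ε : ℝ} (hε : 0 < ε) (n : ℕ)
    (z : TupleChain k K n) (hz : z ∈ Finsupp.supported k k (smallTuples K ε n))
    (hbd : IsCycle n z) :
    ∃ w ∈ Finsupp.supported k k (smallTuples K ε (n + 1)), bd n w = z := by
  cases n with
  | succ n => exact exists_small_filling hK hb c hε n z hz hbd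
  | zero =>
    refine ⟨cone c 0 z, ?_, bd_cone_zero c z⟩
    refine map_mem_of_mem_supported _ _ (fun t ht => ?_) hz
    rw [cone_single]
    refine Finsupp.single_mem_supported _ _ fun i j => ?_
    rw [Subsingleton.elim (α := Fin 1) i j, dist_self]
    exact hε

end TupleChain

/-- Dependent choice along a sequence of types. -/
theorem exists_dependent_seq {α : ℕ → Type*} (P : ∀ n, α n → Prop) (R : ∀ n, α n → α (n + 1) → Prop)
    (a : α 0) (h0 : P 0 a) (hs : ∀ n a, P n a → ∃ a', P (n + 1) a' ∧ R n a a') :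
    ∃ f : ∀ n, α n, f 0 = a ∧ ∀ n, P n (f n) ∧ R n (f n) (f (n + 1)) := by
  choose g hg using hs
  let F : ∀ n, {a : α n // P n a} := fun n =>
    Nat.rec ⟨a, h0⟩ (fun n x => ⟨g n x.1 x.2, (hg n x.1 x.2).1⟩) n
  exact ⟨fun n => (F n).1, rfl, fun n => ⟨(F n).2, (hg n (F n).1 (F n).2).2⟩⟩

namespace SingularChain
variable {k : Type*} {Y : Type*} [CommRing k] [TopologicalSpace Y]

theorem spreadTuple_fundamental_zero (m : ℕ) (z : TupleChain k (Simplex m) 0) :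
    spreadTuple (fundamental k 0) m z = z := by
  have : spreadTuple (fundamental k 0) m = LinearMap.id := by
    refine hom_ext fun t => ?_
    rw [spreadTuple_single, push_fundamental]; rfl
  rw [this]; rfl

/-- A model chain whose boundary is prescribed by the lower model commutes with boundaries. -/
theorem bd_spreadTuple {n : ℕ} {a : TupleChain k (Simplex n) n}
    {a' : TupleChain k (Simplex (n + 1)) (n + 1)}
    (h : TupleChain.bd n a' = spreadTuple a (n + 1) (TupleChain.bd n (fundamental k (n + 1))))
    (m : ℕ) (z : TupleChain k (Simplex m) (n + 1)) :
    TupleChain.bd n (spreadTuple a' m z) = spreadTuple a m (TupleChain.bd n z) := by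
  have : TupleChain.bd n ∘ₗ spreadTuple a' m = spreadTuple a m ∘ₗ TupleChain.bd n := by
    refine hom_ext fun t => ?_
    rw [LinearMap.comp_apply, LinearMap.comp_apply, spreadTuple_single, bd_push, h,
      ← spreadTuple_bd_single]
  exact LinearMap.congr_fun this z

/-- Models, of mesh less than `ε`, for a natural chain map of singular chains: by acyclicity of
the small tuples in a simplex they can be chosen one dimension at a time. -/
theorem exists_small_models (k : Type*) [CommRing k] {ε : ℝ} (hε : 0 < ε) :
    ∃ a : ∀ n, TupleChain k (Simplex n) n, a 0 = fundamental k 0 ∧ ∀ n,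
      a n ∈ Finsupp.supported k k (smallTuples (Simplex n) ε n) ∧
      TupleChain.bd n (a (n + 1)) =
        spreadTuple (a n) (n + 1) (TupleChain.bd n (fundamental k (n + 1))) := by
  obtain ⟨a, ha0, ha⟩ := exists_dependent_seq (α := fun n => TupleChain k (Simplex n) n)
    (P := fun n a => a ∈ Finsupp.supported k k (smallTuples (Simplex n) ε n) ∧
      ∀ m z, IsCycle n z → IsCycle n (spreadTuple a m z))
    (R := fun n a a' => TupleChain.bd n a' =
      spreadTuple a (n + 1) (TupleChain.bd n (fundamental k (n + 1))))
    (fundamental k 0)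
    ⟨Finsupp.single_mem_supported _ _ fun i => i.elim0, fun m z hz => trivial⟩
    (by
      rintro n a ⟨hs, hc⟩
      obtain ⟨w, hw, hwz⟩ := exists_small_filling_of_isCycle (convex_stdSimplex ℝ (Fin (n + 1)))
        (bounded_stdSimplex _) (vertex 0) hε n
        (spreadTuple a (n + 1) (TupleChain.bd n (fundamental k (n + 1))))
        (by
          rw [fundamental, TupleChain.bd_single, map_sum]
          refine Submodule.sum_mem _ fun i _ => ?_
          rw [map_smul, spreadTuple_single]
          refine Submodule.smul_mem _ _ ?_
          refine map_mem_of_mem_supported _ _ (fun t ht => ?_) hs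
          rw [push_single]
          refine Finsupp.single_mem_supported _ _ fun p q => ?_
          exact (dist_face_le i _ _).trans_lt (ht p q))
        (hc _ _ (isCycle_bd n _))
      refine ⟨w, ⟨hw, fun m z hz => ?_⟩, hwz⟩
      change TupleChain.bd n _ = 0
      rw [bd_spreadTuple hwz, show TupleChain.bd n z = 0 from hz, map_zero])
  exact ⟨a, ha0, fun n => ⟨(ha n).1.1, (ha n).2⟩⟩

/-- Models for a natural chain homotopy from the identity to the operator with models `a`: cone off
the defect from a vertex. -/
noncomputable def homotopyModel (a : ∀ n, TupleChain k (Simplex n) n) :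
    ∀ n, TupleChain k (Simplex n) (n + 1)
  | 0 => 0
  | n + 1 => cone (vertex 0) (n + 1) (fundamental k (n + 1) - a (n + 1) -
      spreadTuple (homotopyModel a n) (n + 1) (TupleChain.bd n (fundamental k (n + 1))))

theorem bd_homotopyModel_of_forall {a : ∀ n, TupleChain k (Simplex n) n}
    (ha : ∀ n, TupleChain.bd n (a (n + 1)) =
      spreadTuple (a n) (n + 1) (TupleChain.bd n (fundamental k (n + 1)))) (n : ℕ)
    (ih : ∀ m z, IsCycle n z →
      TupleChain.bd n (spreadTuple (homotopyModel a n) m z) = z - spreadTuple (a n) m z) :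
    TupleChain.bd (n + 1) (homotopyModel a (n + 1)) = fundamental k (n + 1) - a (n + 1) -
      spreadTuple (homotopyModel a n) (n + 1) (TupleChain.bd n (fundamental k (n + 1))) := by
  refine bd_cone_of_isCycle _ (n + 1) _ ?_
  change TupleChain.bd n _ = 0
  rw [map_sub, map_sub, ha, ih _ _ (isCycle_bd n _), sub_self]

theorem bd_spreadTuple_homotopyModel {a : ∀ n, TupleChain k (Simplex n) n}
    (h0 : a 0 = fundamental k 0)
    (ha : ∀ n, TupleChain.bd n (a (n + 1)) =
      spreadTuple (a n) (n + 1) (TupleChain.bd n (fundamental k (n + 1)))) (n m : ℕ)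
    (z : TupleChain k (Simplex m) n) (hz : IsCycle n z) :
    TupleChain.bd n (spreadTuple (homotopyModel a n) m z) = z - spreadTuple (a n) m z := by
  induction n generalizing m with
  | zero =>
    have h : spreadTuple (homotopyModel a 0) m = 0 := hom_ext fun t => by
      rw [spreadTuple_single]; exact map_zero _
    rw [h0, spreadTuple_fundamental_zero, h, LinearMap.zero_apply, map_zero, sub_self]
  | succ n ih =>
    have key : TupleChain.bd (n + 1) ∘ₗ spreadTuple (homotopyModel a (n + 1)) m =
        LinearMap.id - spreadTuple (a (n + 1)) m -
          spreadTuple (homotopyModel a n) m ∘ₗ TupleChain.bd n := by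
      refine hom_ext fun t => ?_
      simp only [LinearMap.comp_apply, LinearMap.sub_apply, LinearMap.id_apply]
      rw [spreadTuple_bd_single, spreadTuple_single, spreadTuple_single, bd_push,
        bd_homotopyModel_of_forall ha n fun m z => ih m z, map_sub, map_sub, push_fundamental]
    have := LinearMap.congr_fun key z
    simp only [LinearMap.comp_apply, LinearMap.sub_apply, LinearMap.id_apply] at this
    rw [this, show TupleChain.bd n z = 0 from hz, map_zero, sub_zero]

theorem bd_spread {a : ∀ n, TupleChain k (Simplex n) n}
    (ha : ∀ n, TupleChain.bd n (a (n + 1)) =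
      spreadTuple (a n) (n + 1) (TupleChain.bd n (fundamental k (n + 1)))) (n : ℕ)
    (z : SingularChain k Y (n + 1)) :
    bd n (spread (a (n + 1)) z) = spread (a n) (bd n z) := by
  have : bd n ∘ₗ spread (a (n + 1)) =
      (spread (a n) ∘ₗ bd n : SingularChain k Y (n + 1) →ₗ[k] _) := by
    refine hom_ext fun σ => ?_
    rw [LinearMap.comp_apply, LinearMap.comp_apply, spread_single, bd_along, ha, spread_bd_single]
  exact LinearMap.congr_fun this z

theorem bd_spread_homotopyModel {a : ∀ n, TupleChain k (Simplex n) n}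
    (h0 : a 0 = fundamental k 0)
    (ha : ∀ n, TupleChain.bd n (a (n + 1)) =
      spreadTuple (a n) (n + 1) (TupleChain.bd n (fundamental k (n + 1)))) (n : ℕ)
    (z : SingularChain k Y (n + 1)) :
    bd (n + 1) (spread (homotopyModel a (n + 1)) z) =
      z - spread (a (n + 1)) z - spread (homotopyModel a n) (bd n z) := by
  have : bd (n + 1) ∘ₗ spread (homotopyModel a (n + 1)) =
      (LinearMap.id - spread (a (n + 1)) - spread (homotopyModel a n) ∘ₗ bd n :
        SingularChain k Y (n + 1) →ₗ[k] _) := by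
    refine hom_ext fun σ => ?_
    simp only [LinearMap.comp_apply, LinearMap.sub_apply, LinearMap.id_apply]
    rw [spread_single, bd_along, spread_bd_single, spread_single,
      bd_homotopyModel_of_forall ha n fun m z => bd_spreadTuple_homotopyModel h0 ha n m z,
      map_sub, map_sub, along_fundamental]
  exact LinearMap.congr_fun this z

/-- The singular simplices whose image lies in a member of `W`. -/
def smallSimplices (W : Set (Set Y)) (n : ℕ) : Set C(Simplex n, Y) :=
  {σ | ∃ V ∈ W, ∀ w, σ w ∈ V}

/-- Subdivision: if every singular cycle of `Y` bounds, then every cycle of simplices subordinate to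
an open cover bounds a chain of simplices subordinate to the cover. -/
theorem exists_subordinate_filling (W : Set (Set Y)) (hW : ∀ V ∈ W, IsOpen V)
    (hcov : ⋃₀ W = Set.univ) (n : ℕ)
    (hex : ∀ z : SingularChain k Y (n + 1), bd n z = 0 → ∃ w, bd (n + 1) w = z)
    (z : SingularChain k Y (n + 1)) (hz : z ∈ Finsupp.supported k k (smallSimplices W (n + 1)))
    (hbd : bd n z = 0) :
    ∃ w ∈ Finsupp.supported k k (smallSimplices W (n + 2)), bd (n + 1) w = z := by
  obtain ⟨w, hw⟩ := hex z hbd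
  have hev : ∀ᶠ ε in nhdsWithin (0 : ℝ) (Set.Ioi 0), 0 < ε ∧
      ∀ σ ∈ w.support, ∀ x, ∃ V ∈ W, ∀ y, dist y x < ε → σ y ∈ V := by
    refine Filter.Eventually.and self_mem_nhdsWithin ?_
    rw [Filter.eventually_all_finset]
    intro σ _
    obtain ⟨δ, hδ, h⟩ := lebesgue_number_lemma_of_metric_sUnion
      (s := (Set.univ : Set (Simplex (n + 2)))) (c := (fun V => σ ⁻¹' V) '' W) isCompact_univ
      (by
        rintro _ ⟨V, hV, rfl⟩
        exact (hW V hV).preimage σ.continuous)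
      (by
        intro x _
        obtain ⟨V, hV, hx⟩ : σ x ∈ ⋃₀ W := hcov ▸ Set.mem_univ _
        exact ⟨_, ⟨V, hV, rfl⟩, hx⟩)
    filter_upwards [Ioo_mem_nhdsGT hδ] with ε hε x
    obtain ⟨_, ⟨V, hV, rfl⟩, hb⟩ := h x trivial
    exact ⟨V, hV, fun y hy => hb (hy.trans hε.2)⟩
  obtain ⟨ε, hε, hsm⟩ := hev.exists
  obtain ⟨a, h0, ha⟩ := exists_small_models k hε
  have ha' := fun n => (ha n).2
  -- Where `bd w = z`, the subdivision of `w` fills that of `z`, and the homotopy, which stays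
  -- inside the simplices of `z`, joins `z` to its subdivision.
  refine ⟨spread (a (n + 2)) w + spread (homotopyModel a (n + 1)) z, Submodule.add_mem _ ?_ ?_, ?_⟩
  · refine map_mem_of_mem_supported _ _ (s := ↑w.support) (fun σ hσ => ?_)
      ((Finsupp.mem_supported _ _).2 subset_rfl)
    rw [spread_single]
    refine map_mem_of_mem_supported _ _ (fun t ht => ?_) (ha (n + 2)).1
    rw [along_single]
    refine Finsupp.single_mem_supported _ _ ?_
    obtain ⟨V, hV, h⟩ := hsm σ hσ (t 0)
    exact ⟨V, hV, fun y => h _ (affine_mem_ball t (t 0) ε (fun i => ht i 0) y)⟩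
  · refine map_mem_of_mem_supported _ _ (fun σ hσ => ?_) hz
    obtain ⟨V, hV, h⟩ := hσ
    rw [spread_single]
    refine map_mem_of_mem_supported _ _ (s := Set.univ) (fun t _ => ?_) (by simp)
    rw [along_single]
    exact Finsupp.single_mem_supported _ _ ⟨V, hV, fun y => h _⟩
  · rw [map_add, bd_spread ha', bd_spread_homotopyModel h0 ha', hbd, map_zero, hw]
    abel

end SingularChain

end SingularChains

/-! ### Singular chains of a contractible space -/

section ContractibleChains

open Simplex TupleChain

namespace Simplex

/-- The projection of a point of the simplex, other than the initial vertex, from that vertex to the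
opposite face. -/
noncomputable def tail {n : ℕ} (w : Simplex (n + 1)) (h : w.1 0 < 1) : Simplex n :=
  ⟨fun j => w.1 j.succ / (1 - w.1 0), fun j => div_nonneg (w.2.1 _) (sub_nonneg.2 h.le), by
    rw [← Finset.sum_div, div_eq_one_iff_eq (sub_pos.2 h).ne']
    have := w.2.2
    rw [Fin.sum_univ_succ] at this
    linarith⟩

theorem face_zero_apply_zero {n : ℕ} (w : Simplex n) : (face 0 w).1 0 = 0 := face_apply_self 0 w

theorem face_zero_apply_succ {n : ℕ} (w : Simplex n) (j : Fin n) : (face 0 w).1 j.succ = w.1 j := by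
  have := face_apply_succAbove 0 w j
  rwa [Fin.succAbove_zero] at this

theorem face_succ_apply_zero {n : ℕ} (i : Fin (n + 1)) (w : Simplex (n + 1)) :
    (face i.succ w).1 0 = w.1 0 := by
  have := face_apply_succAbove i.succ w 0
  rwa [Fin.succ_succAbove_zero] at this

theorem tail_face_zero {n : ℕ} (w : Simplex n) (h : (face 0 w).1 0 < 1) :
    tail (face 0 w) h = w := by
  apply Subtype.ext
  funext j
  simp only [tail, face_zero_apply_succ, face_zero_apply_zero, sub_zero, div_one]

theorem tail_face_succ {n : ℕ} (i : Fin (n + 1)) (w : Simplex (n + 1)) (h : (face i.succ w).1 0 < 1)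
    (h' : w.1 0 < 1) : tail (face i.succ w) h = face i (tail w h') := by
  apply Subtype.ext
  funext j
  simp only [tail, face_succ_apply_zero]
  rcases Fin.eq_self_or_eq_succAbove i j with rfl | ⟨j, rfl⟩
  · rw [face_apply_self, face_apply_self, zero_div]
  · rw [face_apply_succAbove, ← Fin.succ_succAbove_succ, face_apply_succAbove]

end Simplex

namespace SingularChain

variable {k : Type*} {Y : Type*} [CommRing k] [TopologicalSpace Y]

/-- The cone on a singular simplex along a contraction `G` which is constant from time `1 / 2` on.
The constancy makes continuity at the apex evident. -/
noncomputable def coneSimplex (G : ℝ → Y → Y) (hG : Continuous fun p : ℝ × Y => G p.1 p.2) (y : Y)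
    (hy : ∀ s x, 1 / 2 ≤ s → G s x = y) {n : ℕ} (σ : C(Simplex n, Y)) :
    C(Simplex (n + 1), Y) where
  toFun w := if h : w.1 0 < 1 then G (w.1 0) (σ (tail w h)) else y
  continuous_toFun := by
    have hc0 : Continuous fun w : Simplex (n + 1) => w.1 0 :=
      (continuous_apply 0).comp continuous_subtype_val
    rw [continuous_iff_continuousAt]
    intro w
    by_cases h : w.1 0 < 1
    · have ho : IsOpen {w : Simplex (n + 1) | w.1 0 < 1} := isOpen_lt hc0 continuous_const
      refine ContinuousOn.continuousAt (s := {w : Simplex (n + 1) | w.1 0 < 1}) ?_ (ho.mem_nhds h)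
      rw [continuousOn_iff_continuous_domRestrict]
      have hr : Continuous fun w : {w : Simplex (n + 1) | w.1 0 < 1} =>
          G (w.1.1 0) (σ (tail w.1 w.2)) := by
        refine hG.comp ((hc0.comp continuous_subtype_val).prodMk (σ.continuous.comp ?_))
        refine Continuous.subtype_mk (continuous_pi fun j => ?_) _
        refine Continuous.div ?_ ?_ fun x => (sub_pos.2 x.2).ne'
        · exact (continuous_apply _).comp (continuous_subtype_val.comp continuous_subtype_val)
        · exact continuous_const.sub (hc0.comp continuous_subtype_val)
      refine hr.congr fun w => ?_
      have hw : w.1.1 0 < 1 := w.2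
      simp only [Set.domRestrict_apply]
      rw [dif_pos hw]
    · have hw : (1 : ℝ) / 2 < w.1 0 := by linarith
      refine (continuousAt_const (y := y)).congr ?_
      filter_upwards [(isOpen_lt continuous_const hc0).mem_nhds hw] with v hv
      split_ifs
      · exact (hy _ _ (le_of_lt hv)).symm
      · rfl

variable (G : ℝ → Y → Y) (hG : Continuous fun p : ℝ × Y => G p.1 p.2) (y : Y)
    (hy : ∀ s x, 1 / 2 ≤ s → G s x = y)

theorem coneSimplex_apply {n : ℕ} (σ : C(Simplex n, Y)) (w : Simplex (n + 1)) :
    coneSimplex G hG y hy σ w = if h : w.1 0 < 1 then G (w.1 0) (σ (tail w h)) else y := rfl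

theorem coneSimplex_comp_face_zero (hG0 : ∀ x, G 0 x = x) {n : ℕ} (σ : C(Simplex n, Y)) :
    (coneSimplex G hG y hy σ).comp (face 0) = σ := by
  ext w
  rw [ContinuousMap.comp_apply, coneSimplex_apply,
    dif_pos (by rw [face_zero_apply_zero]; exact zero_lt_one), tail_face_zero,
    face_zero_apply_zero, hG0]

theorem coneSimplex_comp_face_succ {n : ℕ} (σ : C(Simplex (n + 1), Y)) (i : Fin (n + 1)) :
    (coneSimplex G hG y hy σ).comp (face i.succ) = coneSimplex G hG y hy (σ.comp (face i)) := by
  ext w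
  simp only [ContinuousMap.comp_apply, coneSimplex_apply]
  by_cases h : w.1 0 < 1
  · rw [dif_pos h, dif_pos (by rwa [face_succ_apply_zero]), tail_face_succ i w _ h,
      face_succ_apply_zero]
  · rw [dif_neg h, dif_neg (by rwa [face_succ_apply_zero])]

/-- The augmented singular complex of a contractible space is exact: every cycle bounds its cone. -/
theorem exists_bd_eq_of_contractible [ContractibleSpace Y] (n : ℕ) (z : SingularChain k Y (n + 1))
    (hz : bd n z = 0) : ∃ w, bd (n + 1) w = z := by
  obtain ⟨y, ⟨F⟩⟩ := id_nullhomotopic Y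
  let G : ℝ → Y → Y := fun s x => F (Set.projIcc 0 1 zero_le_one (2 * s), x)
  have hG : Continuous fun p : ℝ × Y => G p.1 p.2 := by
    refine F.continuous.comp (Continuous.prodMk ?_ continuous_snd)
    exact continuous_projIcc.comp (continuous_const.mul continuous_fst)
  have hy : ∀ s x, 1 / 2 ≤ s → G s x = y := by
    intro s x hs
    simp only [G]
    rw [Set.projIcc_of_right_le _ (by linarith)]
    simp
  have hG0 : ∀ x, G 0 x = x := by
    intro x
    simp only [G, mul_zero]
    rw [Set.projIcc_of_le_left _ le_rfl]
    simp
  obtain ⟨c, hcs⟩ : ∃ c : ∀ n, SingularChain k Y n →ₗ[k] SingularChain k Y (n + 1),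
      ∀ n (σ : C(Simplex n, Y)), c n (Finsupp.single σ 1) =
        Finsupp.single (coneSimplex G hG y hy σ) 1 :=
    ⟨fun n => Finsupp.lmapDomain k k (coneSimplex G hG y hy), fun n σ => by
      simp [Finsupp.mapDomain_single]⟩
  have hc : bd (n + 1) ∘ₗ c (n + 1) =
      (LinearMap.id : SingularChain k Y (n + 1) →ₗ[k] _) - c n ∘ₗ bd n := by
    refine hom_ext fun σ => ?_
    simp only [LinearMap.comp_apply, LinearMap.sub_apply, LinearMap.id_apply, hcs, bd_single,
      map_sum, map_smul]
    rw [Fin.sum_univ_succ, coneSimplex_comp_face_zero G hG y hy hG0]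
    simp only [coneSimplex_comp_face_succ,
      Fin.val_zero, pow_zero, one_smul, Fin.val_succ, pow_succ, mul_neg, mul_one,
      neg_smul, Finset.sum_neg_distrib, sub_eq_add_neg]
  refine ⟨c (n + 1) z, ?_⟩
  have := LinearMap.congr_fun hc z
  simpa [hz] using this

end SingularChain

end ContractibleChains

/-! ### Cup products of `1`-cocycles as chain maps -/

section CupProduct

namespace TupleChain

variable {k : Type*} {X Y : Type*} [CommRing k]

/-- The join of a formal combination of points with an ordered chain, linearizing `cone`. -/
noncomputable def join (n : ℕ) :
    (X →₀ k) →ₗ[k] TupleChain k X n →ₗ[k] TupleChain k X (n + 1) :=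
  Finsupp.linearCombination k fun x => cone x n

/-- The augmentation, or sum of the coefficients. -/
noncomputable def aug : (X →₀ k) →ₗ[k] k := Finsupp.linearCombination k fun _ => 1

theorem join_single (n : ℕ) (x : X) (z : TupleChain k X n) :
    join n (Finsupp.single x 1) z = cone x n z := by
  simp [join]

theorem bd_join_of_isCycle (n : ℕ) (q : X →₀ k) (z : TupleChain k X n) (hz : IsCycle n z) :
    bd n (join n q z) = aug q • z := by
  have : (bd n ∘ₗ LinearMap.applyₗ z) ∘ₗ join n = LinearMap.toSpanSingleton k _ z ∘ₗ aug := by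
    refine hom_ext fun x => ?_
    simp [join_single, aug, bd_cone_of_isCycle x n z hz]
  exact LinearMap.congr_fun this q

theorem push_join (f : X → X) (n : ℕ) (q : X →₀ k) (z : TupleChain k X n) :
    push f (n + 1) (join n q z) = join n (Finsupp.mapDomain f q) (push f n z) := by
  have : (push f (n + 1) ∘ₗ LinearMap.applyₗ z) ∘ₗ join n =
      (LinearMap.applyₗ (push f n z) ∘ₗ join n) ∘ₗ Finsupp.lmapDomain k k f := by
    refine hom_ext fun x => ?_
    simp [join_single, push_cone, Finsupp.mapDomain_single]
  exact LinearMap.congr_fun this q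

/-- The chain map `TupleChain k Y → TupleChain k X` over the augmentation built from functions
`p n : Y → (X →₀ k)` by coning the image of the boundary with `p n` of the initial vertex. Written
out, it sends `(y₀, …, yₙ)` to the join of `p n y₀`, `p (n - 1) y₁ - p (n - 1) y₀`, …,
`p 0 yₙ - p 0 yₙ₋₁`: a cup product of `1`-cocycles. -/
noncomputable def cupMap (p : ℕ → Y → X →₀ k) : ∀ n, TupleChain k Y n →ₗ[k] TupleChain k X n
  | 0 => Finsupp.lmapDomain k k fun _ => Fin.elim0
  | n + 1 => Finsupp.linearCombination k fun t =>
      join n (p n (t 0)) (cupMap p n (bd n (Finsupp.single t 1)))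

theorem cupMap_single (p : ℕ → Y → X →₀ k) (n : ℕ) (t : Fin (n + 1) → Y) :
    cupMap p (n + 1) (Finsupp.single t 1) =
      join n (p n (t 0)) (cupMap p n (bd n (Finsupp.single t 1))) := by
  simp [cupMap]

theorem cupMap_cone (p : ℕ → Y → X →₀ k) (n : ℕ) (y : Y) (z : TupleChain k Y n) :
    cupMap p (n + 1) (cone y n z) = join n (p n y) (cupMap p n (bd n (cone y n z))) := by
  have : cupMap p (n + 1) ∘ₗ cone y n =
      join n (p n y) ∘ₗ cupMap p n ∘ₗ bd n ∘ₗ cone y n := by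
    refine hom_ext fun t => ?_
    simp [cupMap_single]
  exact LinearMap.congr_fun this z

theorem bd_cupMap (p : ℕ → Y → X →₀ k) (hp : ∀ n y, aug (p n y) = 1) (n : ℕ)
    (z : TupleChain k Y (n + 1)) :
    bd n (cupMap p (n + 1) z) = cupMap p n (bd n z) := by
  induction n with
  | zero =>
    have : bd 0 ∘ₗ cupMap p 1 = cupMap p 0 ∘ₗ bd 0 := by
      refine hom_ext fun t => ?_
      rw [LinearMap.comp_apply, cupMap_single, bd_join_of_isCycle 0 _ _ trivial, hp, one_smul]
      rfl
    exact LinearMap.congr_fun this z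
  | succ n ih =>
    have : bd (n + 1) ∘ₗ cupMap p (n + 2) = cupMap p (n + 1) ∘ₗ bd (n + 1) := by
      refine hom_ext fun t => ?_
      rw [LinearMap.comp_apply, cupMap_single, bd_join_of_isCycle, hp, one_smul]
      · rfl
      · change bd n _ = 0
        rw [ih, bd_bd, map_zero]
    exact LinearMap.congr_fun this z

theorem push_cupMap (p : ℕ → Y → X →₀ k) (f : X → X) (g : Y → Y)
    (hp : ∀ n y, p n (g y) = Finsupp.mapDomain f (p n y)) (n : ℕ) (z : TupleChain k Y n) :
    push f n (cupMap p n z) = cupMap p n (push g n z) := by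
  induction n with
  | zero =>
    have : push f 0 ∘ₗ cupMap p 0 = cupMap p 0 ∘ₗ push g 0 := by
      refine hom_ext fun t => ?_
      simp only [LinearMap.comp_apply, cupMap, Finsupp.lmapDomain_apply, Finsupp.mapDomain_single,
        push_single]
      rw [Subsingleton.elim (f ∘ _) _]
    exact LinearMap.congr_fun this z
  | succ n ih =>
    have : push f (n + 1) ∘ₗ cupMap p (n + 1) = cupMap p (n + 1) ∘ₗ push g (n + 1) := by
      refine hom_ext fun t => ?_
      rw [LinearMap.comp_apply, LinearMap.comp_apply, cupMap_single, push_join, ih, ← bd_push,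
        push_single, cupMap_single, ← hp]
      rfl
    exact LinearMap.congr_fun this z

theorem cupMap_bd_single (p : ℕ → Y → X →₀ k) (n : ℕ) (t : Fin (n + 2) → Y) :
    cupMap p (n + 1) (bd (n + 1) (Finsupp.single t 1)) =
      join n (p n (t 1) - p n (t 0)) (cupMap p n (bd n (Finsupp.single (Fin.tail t) 1))) := by
  rw [single_eq_cone, bd_cone, map_sub, cupMap_cone, cupMap_single,
    bd_cone_of_isCycle _ _ _ (isCycle_bd n _), map_sub, LinearMap.sub_apply]
  rfl

/-- A cup product vanishes on a tuple on whose vertices one of the factors is constant. -/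
theorem cupMap_bd_eq_zero (p : ℕ → Y → X →₀ k) (n j : ℕ) (hj : j ≤ n) (t : Fin (n + 2) → Y)
    (ht : ∀ a b, p j (t a) = p j (t b)) :
    cupMap p (n + 1) (bd (n + 1) (Finsupp.single t 1)) = 0 := by
  induction n with
  | zero =>
    obtain rfl : j = 0 := by omega
    rw [cupMap_bd_single, ht 1 0, sub_self, map_zero, LinearMap.zero_apply]
  | succ n ih =>
    rw [cupMap_bd_single]
    rcases hj.lt_or_eq with h | rfl
    · rw [ih (by omega) (Fin.tail t) fun a b => ht _ _, map_zero]
    · rw [ht 1 0, sub_self, map_zero, LinearMap.zero_apply]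

theorem cupMap_eq_zero (p : ℕ → Y → X →₀ k) (n j : ℕ) (hj : j ≤ n) (t : Fin (n + 2) → Y)
    (ht : ∀ a b, p j (t a) = p j (t b)) :
    cupMap p (n + 2) (Finsupp.single t 1) = 0 := by
  rw [cupMap_single, cupMap_bd_eq_zero p n j hj t ht, map_zero]

end TupleChain

end CupProduct

/-! ### Equivariant lifts to subordinate singular chains -/

section EquivariantLift

open Simplex TupleChain

namespace SingularChain

variable {k : Type*} {Y : Type*} [CommRing k] [TopologicalSpace Y]

/-- The cycles of the augmented singular complex; in length `0` every chain is a cycle. -/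
def IsCycle : ∀ n, SingularChain k Y n → Prop
  | 0, _ => True
  | n + 1, z => bd n z = 0

/-- The chain map sending a singular simplex to the tuple of its vertices. -/
noncomputable def vertices (n : ℕ) : SingularChain k Y n →ₗ[k] TupleChain k Y n :=
  Finsupp.lmapDomain k k fun σ => σ ∘ vertex

@[simp] theorem vertices_single (n : ℕ) (σ : C(Simplex n, Y)) :
    vertices n (Finsupp.single σ (1 : k)) = Finsupp.single (σ ∘ vertex) 1 := by
  simp [vertices, Finsupp.mapDomain_single]

theorem bd_vertices (n : ℕ) (z : SingularChain k Y (n + 1)) :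
    TupleChain.bd n (vertices (n + 1) z) = vertices n (bd n z) := by
  have : TupleChain.bd n ∘ₗ vertices (n + 1) =
      (vertices n ∘ₗ bd n : SingularChain k Y (n + 1) →ₗ[k] _) := by
    refine hom_ext fun σ => ?_
    simp only [LinearMap.comp_apply, vertices_single, TupleChain.bd_single, bd_single, map_sum,
      map_smul, ContinuousMap.coe_comp, face, Function.comp_assoc, affine_comp_vertex]
  exact LinearMap.congr_fun this z

theorem exists_subordinate_filling_of_isCycle [ContractibleSpace Y] (W : Set (Set Y))
    (hW : ∀ V ∈ W, IsOpen V) (hcov : ⋃₀ W = Set.univ) (n : ℕ) (z : SingularChain k Y n)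
    (hz : z ∈ Finsupp.supported k k (smallSimplices W n)) (hbd : IsCycle n z) :
    ∃ w ∈ Finsupp.supported k k (smallSimplices W (n + 1)), bd n w = z := by
  cases n with
  | succ n =>
    exact exists_subordinate_filling W hW hcov n (exists_bd_eq_of_contractible n) z hz hbd
  | zero =>
    obtain ⟨y⟩ : Nonempty Y := inferInstance
    obtain ⟨V, hV, hy⟩ : y ∈ ⋃₀ W := hcov ▸ Set.mem_univ _
    let σ : C(Simplex 1, Y) := ContinuousMap.const _ y
    have h0 (τ τ' : C(Simplex 0, Y)) : τ = τ' := by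
      ext w
      have := w.2.2
      simp at this
    refine ⟨z (σ.comp (face 0)) • Finsupp.single σ 1,
      Submodule.smul_mem _ _ (Finsupp.single_mem_supported _ _ ⟨V, hV, fun _ => hy⟩), ?_⟩
    rw [map_smul, bd_single, Fin.sum_univ_one]
    ext τ
    rw [h0 τ (σ.comp (face 0))]
    simp

section Action

variable {Λ : Type*} [Group Λ] [MulAction Λ Y] [ContinuousConstSMul Λ Y]

/-- Translation of singular chains by a group element. -/
noncomputable def translate (g : Λ) (n : ℕ) : SingularChain k Y n →ₗ[k] SingularChain k Y n :=
  Finsupp.lmapDomain k k fun σ =>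
    (ContinuousMap.mk (fun y : Y => g • y) (continuous_const_smul g)).comp σ

@[simp] theorem translate_single (g : Λ) (n : ℕ) (σ : C(Simplex n, Y))
    (a : k) : translate g n (Finsupp.single σ a) = Finsupp.single
      ((ContinuousMap.mk (fun y : Y => g • y) (continuous_const_smul g)).comp σ) a := by
  simp [translate, Finsupp.mapDomain_single]

theorem bd_translate (g : Λ) (n : ℕ) (z : SingularChain k Y (n + 1)) :
    bd n (translate g (n + 1) z) = translate g n (bd n z) := by
  have : bd n ∘ₗ translate g (n + 1) =
      (translate g n ∘ₗ bd n : SingularChain k Y (n + 1) →ₗ[k] _) := by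
    refine hom_ext fun σ => ?_
    simp [bd_single, ContinuousMap.comp_assoc]
  exact LinearMap.congr_fun this z

theorem translate_translate (g h : Λ) (n : ℕ) (z : SingularChain k Y n) :
    translate g n (translate h n z) = translate (g * h) n z := by
  have : translate g n ∘ₗ translate h n =
      (translate (g * h) n : SingularChain k Y n →ₗ[k] _) := by
    refine hom_ext fun σ => ?_
    simp only [LinearMap.comp_apply, translate_single]
    congr 1
    ext w
    simp [mul_smul]
  exact LinearMap.congr_fun this z

theorem vertices_translate (g : Λ) (n : ℕ) (z : SingularChain k Y n) :
    vertices n (translate g n z) = push (fun y : Y => g • y) n (vertices n z) := by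
  have : vertices n ∘ₗ translate g n =
      (push (fun y : Y => g • y) n ∘ₗ vertices n : SingularChain k Y n →ₗ[k] _) := by
    refine hom_ext fun σ => ?_
    simp only [LinearMap.comp_apply, translate_single, vertices_single, push_single]
    rfl
  exact LinearMap.congr_fun this z

/-- Ordered chains of `Λ` are free over `Λ`, so that they map equivariantly to the singular chains
subordinate to an invariant open cover of a contractible space. -/
theorem exists_equivariant_lift [ContractibleSpace Y] (W : Set (Set Y))
    (hW : ∀ V ∈ W, IsOpen V) (hcov : ⋃₀ W = Set.univ)
    (hinv : ∀ (g : Λ), ∀ V ∈ W, ∃ V' ∈ W, ∀ y ∈ V, g • y ∈ V') :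
    ∃ L : ∀ n, TupleChain k Λ n →ₗ[k] SingularChain k Y n,
      (∀ n z, L n z ∈ Finsupp.supported k k (smallSimplices W n)) ∧
      (∀ n g z, L n (push (fun h => g * h) n z) = translate g n (L n z)) ∧
      (∀ n z, bd n (L (n + 1) z) = L n (TupleChain.bd n z)) ∧
      ∀ t, ∃ σ, L 0 (Finsupp.single t 1) = Finsupp.single σ 1 := by
  obtain ⟨y⟩ : Nonempty Y := inferInstance
  obtain ⟨V, hV, -⟩ : y ∈ ⋃₀ W := hcov ▸ Set.mem_univ _
  have hempty (w : Simplex 0) : False := by simpa using w.2.2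
  let σ₀ : C(Simplex 0, Y) := ContinuousMap.const _ y
  have hσ₀ (τ : C(Simplex 0, Y)) : τ = σ₀ := by ext w; exact (hempty w).elim
  obtain ⟨L, hL0, hL⟩ := exists_dependent_seq
    (α := fun n => TupleChain k Λ n →ₗ[k] SingularChain k Y n)
    (P := fun n f => (∀ z, f z ∈ Finsupp.supported k k (smallSimplices W n)) ∧
      (∀ g z, f (push (fun h => g * h) n z) = translate g n (f z)) ∧
      ∀ z, TupleChain.IsCycle n z → IsCycle n (f z))
    (R := fun n f f' => ∀ z, bd n (f' z) = f (TupleChain.bd n z))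
    (Finsupp.lmapDomain k k fun _ => σ₀)
    (by
      refine ⟨fun z => ?_, fun g z => ?_, fun z _ => trivial⟩
      · refine map_mem_of_mem_supported _ _ (s := Set.univ) (fun t _ => ?_) (by simp)
        rw [Finsupp.lmapDomain_apply, Finsupp.mapDomain_single]
        exact Finsupp.single_mem_supported _ _ ⟨V, hV, fun w => (hempty w).elim⟩
      · have : (Finsupp.lmapDomain k k fun _ => σ₀) ∘ₗ push (fun h => g * h) 0 =
            translate g 0 ∘ₗ (Finsupp.lmapDomain k k fun _ => σ₀) := by
          refine hom_ext fun t => ?_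
          simp only [LinearMap.comp_apply, Finsupp.lmapDomain_apply, Finsupp.mapDomain_single,
            push_single, translate_single]
          rw [hσ₀ (ContinuousMap.comp _ _)]
        exact LinearMap.congr_fun this z)
    (by
      rintro n f ⟨hfs, hfe, hfc⟩
      have hfill (t : Fin (n + 1) → Λ) : ∃ w ∈ Finsupp.supported k k (smallSimplices W (n + 1)),
          bd n w = f (TupleChain.bd n (Finsupp.single t 1)) :=
        exists_subordinate_filling_of_isCycle W hW hcov n _ (hfs _) (hfc _ (isCycle_bd n _))
      choose w hws hwb using hfill
      -- Tuples with initial vertex `1` form a basis over `Λ`; `f'` extends `w` equivariantly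
      -- from it.
      let f' : TupleChain k Λ (n + 1) →ₗ[k] SingularChain k Y (n + 1) :=
        Finsupp.linearCombination k fun t =>
          translate (t 0) (n + 1) (w fun i => (t 0)⁻¹ * t i)
      have hf' (t : Fin (n + 1) → Λ) : f' (Finsupp.single t 1) =
          translate (t 0) (n + 1) (w fun i => (t 0)⁻¹ * t i) := by simp [f']
      have hbd : ∀ z, bd n (f' z) = f (TupleChain.bd n z) := by
        have : bd n ∘ₗ f' = f ∘ₗ TupleChain.bd n := by
          refine hom_ext fun t => ?_
          rw [LinearMap.comp_apply, LinearMap.comp_apply, hf', bd_translate, hwb, ← hfe, ← bd_push,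
            push_single]
          congr 4
          ext i
          simp
        exact LinearMap.congr_fun this
      refine ⟨f', ⟨fun z => ?_, fun g => ?_, fun z hz => ?_⟩, hbd⟩
      · refine map_mem_of_mem_supported _ _ (s := Set.univ) (fun t _ => ?_) (by simp)
        rw [hf']
        refine map_mem_of_mem_supported _ _ (fun σ hσ => ?_) (hws _)
        rw [translate_single]
        obtain ⟨V, hV, h⟩ := hσ
        obtain ⟨V', hV', h'⟩ := hinv (t 0) V hV
        exact Finsupp.single_mem_supported _ _ ⟨V', hV', fun w => h' _ (h w)⟩
      · have : f' ∘ₗ push (fun h => g * h) (n + 1) = translate g (n + 1) ∘ₗ f' := by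
          refine hom_ext fun t => ?_
          rw [LinearMap.comp_apply, LinearMap.comp_apply, push_single, hf', hf',
            translate_translate]
          simp [mul_assoc]
        exact LinearMap.congr_fun this
      · change bd n _ = 0
        rw [hbd, show TupleChain.bd n z = 0 from hz, map_zero])
  refine ⟨L, fun n => (hL n).1.1, fun n => (hL n).1.2.1, fun n => (hL n).2, fun t => ⟨σ₀, ?_⟩⟩
  rw [hL0, Finsupp.lmapDomain_apply, Finsupp.mapDomain_single]

end Action

end SingularChain

end EquivariantLift

/-! ### The equivariant contraction -/

section Homotopy

open TupleChain SingularChain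

namespace TupleChain

variable {k : Type*} [CommRing k] {Λ : Type*}

/-- The cone homotopy between the identity of the ordered chains of `Λ` and a chain map `F`. Coning
off from the initial vertex makes it as equivariant as `F` is. -/
noncomputable def coneHomotopy (F : ∀ n, TupleChain k Λ n →ₗ[k] TupleChain k Λ n) :
    ∀ n, TupleChain k Λ n →ₗ[k] TupleChain k Λ (n + 1)
  | 0 => 0
  | n + 1 => Finsupp.linearCombination k fun t =>
      cone (t 0) (n + 1) (Finsupp.single t 1 - F (n + 1) (Finsupp.single t 1) -
        coneHomotopy F n (bd n (Finsupp.single t 1)))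

theorem coneHomotopy_single (F : ∀ n, TupleChain k Λ n →ₗ[k] TupleChain k Λ n) (n : ℕ)
    (t : Fin (n + 1) → Λ) :
    coneHomotopy F (n + 1) (Finsupp.single t 1) =
      cone (t 0) (n + 1) (Finsupp.single t 1 - F (n + 1) (Finsupp.single t 1) -
        coneHomotopy F n (bd n (Finsupp.single t 1))) := by
  simp [coneHomotopy]

theorem push_coneHomotopy (F : ∀ n, TupleChain k Λ n →ₗ[k] TupleChain k Λ n) (f : Λ → Λ)
    (hF : ∀ n z, push f n (F n z) = F n (push f n z)) (n : ℕ) (z : TupleChain k Λ n) :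
    push f (n + 1) (coneHomotopy F n z) = coneHomotopy F n (push f n z) := by
  induction n with
  | zero => simp [coneHomotopy]
  | succ n ih =>
    have : push f (n + 2) ∘ₗ coneHomotopy F (n + 1) =
        coneHomotopy F (n + 1) ∘ₗ push f (n + 1) := by
      refine hom_ext fun t => ?_
      rw [LinearMap.comp_apply, LinearMap.comp_apply, coneHomotopy_single, push_cone,
        push_single, coneHomotopy_single]
      simp only [map_sub, ih, hF, ← bd_push, push_single]
      rfl
    exact LinearMap.congr_fun this z

theorem bd_coneHomotopy_of_forall (F : ∀ n, TupleChain k Λ n →ₗ[k] TupleChain k Λ n)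
    (hF : ∀ n z, bd n (F (n + 1) z) = F n (bd n z)) (n : ℕ)
    (ih : ∀ z, IsCycle n z → bd n (coneHomotopy F n z) = z - F n z)
    (z : TupleChain k Λ (n + 1)) :
    bd (n + 1) (coneHomotopy F (n + 1) z) = z - F (n + 1) z - coneHomotopy F n (bd n z) := by
  have : bd (n + 1) ∘ₗ coneHomotopy F (n + 1) =
      LinearMap.id - F (n + 1) - coneHomotopy F n ∘ₗ bd n := by
    refine hom_ext fun t => ?_
    rw [LinearMap.comp_apply, coneHomotopy_single, bd_cone_of_isCycle]
    · rfl
    · change bd n _ = 0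
      rw [map_sub, map_sub, hF, ih _ (isCycle_bd n _), sub_self]
  exact LinearMap.congr_fun this z

theorem bd_coneHomotopy_of_isCycle (F : ∀ n, TupleChain k Λ n →ₗ[k] TupleChain k Λ n)
    (hF : ∀ n z, bd n (F (n + 1) z) = F n (bd n z)) (hF0 : ∀ z, F 0 z = z) (n : ℕ)
    (z : TupleChain k Λ n) (hz : IsCycle n z) : bd n (coneHomotopy F n z) = z - F n z := by
  induction n with
  | zero => simp [coneHomotopy, hF0]
  | succ n ih =>
    rw [bd_coneHomotopy_of_forall F hF n ih, show bd n z = 0 from hz, map_zero, sub_zero]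

theorem bd_coneHomotopy (F : ∀ n, TupleChain k Λ n →ₗ[k] TupleChain k Λ n)
    (hF : ∀ n z, bd n (F (n + 1) z) = F n (bd n z)) (hF0 : ∀ z, F 0 z = z) (n : ℕ)
    (z : TupleChain k Λ (n + 1)) :
    bd (n + 1) (coneHomotopy F (n + 1) z) = z - F (n + 1) z - coneHomotopy F n (bd n z) :=
  bd_coneHomotopy_of_forall F hF n (bd_coneHomotopy_of_isCycle F hF hF0 n) z

/-- If `Λ` acts on a contractible space `Y` with an invariant open cover, each member of which is
in the constancy set of one of `d + 1` equivariant functions `p 0, …, p d` into `k[Λ]` of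
augmentation `1`, then the ordered chains of `Λ` have an equivariant contraction in lengths at least
`d + 2`: the composite of the lift to subordinate singular chains with `cupMap p` is homotopic to
the identity, and it vanishes there. -/
theorem exists_equivariant_contraction [Group Λ] {Y : Type*} [TopologicalSpace Y] [MulAction Λ Y]
    [ContinuousConstSMul Λ Y] [ContractibleSpace Y] (W : Set (Set Y))
    (hW : ∀ V ∈ W, IsOpen V) (hcov : ⋃₀ W = Set.univ)
    (hinv : ∀ (g : Λ), ∀ V ∈ W, ∃ V' ∈ W, ∀ y ∈ V, g • y ∈ V')
    (p : ℕ → Y → Λ →₀ k) (haug : ∀ n y, aug (p n y) = 1)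
    (hp : ∀ n (g : Λ) y, p n (g • y) = Finsupp.mapDomain (fun h => g * h) (p n y)) (d : ℕ)
    (hconst : ∀ V ∈ W, ∃ j ≤ d, ∀ y ∈ V, ∀ y' ∈ V, p j y = p j y') :
    ∃ s : ∀ n, TupleChain k Λ n →ₗ[k] TupleChain k Λ (n + 1),
      (∀ n (g : Λ) z, push (fun h => g * h) (n + 1) (s n z) = s n (push (fun h => g * h) n z)) ∧
      ∀ n, d + 1 ≤ n → ∀ z, bd (n + 1) (s (n + 1) z) + s n (bd n z) = z := by
  obtain ⟨L, hLs, hLe, hLb, hL0⟩ := exists_equivariant_lift (k := k) W hW hcov hinv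
  let F : ∀ n, TupleChain k Λ n →ₗ[k] TupleChain k Λ n := fun n =>
    cupMap p n ∘ₗ vertices n ∘ₗ L n
  have hF (n) (z) : bd n (F (n + 1) z) = F n (bd n z) := by
    simp only [F, LinearMap.comp_apply]
    rw [bd_cupMap p haug, bd_vertices, hLb]
  have hF0 (z) : F 0 z = z := by
    have : F 0 = LinearMap.id := by
      refine hom_ext fun t => ?_
      obtain ⟨σ, hσ⟩ := hL0 t
      simp only [F, LinearMap.comp_apply, hσ, vertices_single, cupMap, Finsupp.lmapDomain_apply,
        Finsupp.mapDomain_single, LinearMap.id_apply]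
      rw [Subsingleton.elim t]
    rw [this, LinearMap.id_apply]
  refine ⟨coneHomotopy F, fun n g z => push_coneHomotopy F _ (fun n z => ?_) n z, fun n hn z => ?_⟩
  · simp only [F, LinearMap.comp_apply]
    rw [push_cupMap p _ (fun y => g • y) (fun n y => hp n g y), hLe, vertices_translate]
  · rw [bd_coneHomotopy F hF hF0]
    have hzero : F (n + 1) z = 0 := by
      obtain ⟨n, rfl⟩ : ∃ m, n = m + 1 := ⟨n - 1, by omega⟩
      have := map_mem_of_mem_supported (cupMap p (n + 2) ∘ₗ vertices (n + 2)) ⊥ (fun σ hσ => ?_)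
        (hLs (n + 2) z)
      · exact (Submodule.mem_bot k).1 this
      · obtain ⟨V, hV, h⟩ := hσ
        obtain ⟨j, hj, hc⟩ := hconst V hV
        rw [Submodule.mem_bot, LinearMap.comp_apply, vertices_single]
        exact cupMap_eq_zero p n j (by omega) _ fun a b => hc _ (h _) _ (h _)
    rw [hzero]
    abel

end TupleChain

end Homotopy

/-! ### Contractions of the ordered chains of a group and group cohomology -/

section GroupCohomology

open CategoryTheory TupleChain

variable {k G : Type u} [CommRing k] [Group G]

/-- The terms of the standard resolution are the ordered chains of the group. -/
noncomputable def standardTermEquiv (k G : Type u) [CommRing k] [Group G] (n : ℕ) :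
    (Rep.standardComplex k G).X n ≃ₗ[k] TupleChain k G (n + 1) :=
  MonoidAlgebra.coeffLinearEquiv k (S := k) (M := Fin (n + 1) → G)

theorem standardTermEquiv_d (n : ℕ) (z : (Rep.standardComplex k G).X (n + 1)) :
    standardTermEquiv k G n (((Rep.standardComplex k G).d (n + 1) n).hom z) =
      bd (n + 1) (standardTermEquiv k G (n + 1) z) := by
  have h := Rep.standardComplex.d_apply k G (n := n) z
  rw [show ((Rep.standardComplex k G).d (n + 1) n).hom z = _ from h]
  have : (MonoidAlgebra.coeffLinearEquiv k).toLinearMap ∘ₗ Rep.standardComplex.d k G (n + 1) =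
      bd (n + 1) ∘ₗ (MonoidAlgebra.coeffLinearEquiv k).toLinearMap := by
    refine MonoidAlgebra.lhom_ext' fun t => LinearMap.ext_ring ?_
    simp [bd_single]
  exact LinearMap.congr_fun this z

theorem standardTermEquiv_ρ (n : ℕ) (g : G) (z : (Rep.standardComplex k G).X n) :
    standardTermEquiv k G n (((Rep.standardComplex k G).X n).ρ g z) =
      push (fun h => g * h) (n + 1) (standardTermEquiv k G n z) := by
  have : (MonoidAlgebra.coeffLinearEquiv k).toLinearMap ∘ₗ
        Representation.ofMulAction k G (Fin (n + 1) → G) g =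
      push (fun h => g * h) (n + 1) ∘ₗ (MonoidAlgebra.coeffLinearEquiv k).toLinearMap := by
    refine MonoidAlgebra.lhom_ext' fun t => LinearMap.ext_ring ?_
    simp
    rfl
  exact LinearMap.congr_fun this z

/-- An equivariant map of ordered chains, as a morphism between terms of the standard resolution. -/
noncomputable def standardHom (n m : ℕ) (f : TupleChain k G (n + 1) →ₗ[k] TupleChain k G (m + 1))
    (hf : ∀ (g : G) z, push (fun h => g * h) (m + 1) (f z) = f (push (fun h => g * h) (n + 1) z)) :
    (Rep.standardComplex k G).X n ⟶ (Rep.standardComplex k G).X m :=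
  Rep.ofHom ⟨(standardTermEquiv k G m).symm.toLinearMap ∘ₗ f ∘ₗ
    (standardTermEquiv k G n).toLinearMap, fun g => by
      refine LinearMap.ext fun z => (standardTermEquiv k G m).injective ?_
      have h₁ := standardTermEquiv_ρ n g z
      have h₂ := standardTermEquiv_ρ m g
        ((standardTermEquiv k G m).symm (f (standardTermEquiv k G n z)))
      rw [LinearEquiv.apply_symm_apply, hf, ← h₁] at h₂
      exact ((standardTermEquiv k G m).apply_symm_apply _).trans h₂.symm⟩

theorem standardTermEquiv_standardHom (n m : ℕ)
    (f : TupleChain k G (n + 1) →ₗ[k] TupleChain k G (m + 1))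
    (hf : ∀ (g : G) z, push (fun h => g * h) (m + 1) (f z) = f (push (fun h => g * h) (n + 1) z))
    (z : (Rep.standardComplex k G).X n) :
    standardTermEquiv k G m ((standardHom n m f hf).hom z) = f (standardTermEquiv k G n z) := by
  change standardTermEquiv k G m ((standardTermEquiv k G m).symm _) = _
  rw [LinearEquiv.apply_symm_apply]
  rfl

/-- An equivariant contraction of the ordered chains in one degree of the standard resolution kills
the cohomology in that degree, for all coefficients. -/
theorem subsingleton_groupCohomology_of_contraction
    (s : ∀ n, TupleChain k G n →ₗ[k] TupleChain k G (n + 1))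
    (hs : ∀ n (g : G) z, push (fun h => g * h) (n + 1) (s n z) = s n (push (fun h => g * h) n z))
    (n : ℕ) (hc : ∀ z, bd (n + 2) (s (n + 2) z) + s (n + 1) (bd (n + 1) z) = z) (A : Rep.{u} k G) :
    Subsingleton (groupCohomology A (n + 1)) := by
  let h₁ := standardHom (n + 1) (n + 2) (s (n + 2)) (hs (n + 2))
  let h₀ := standardHom n (n + 1) (s (n + 1)) (hs (n + 1))
  have hid : h₁ ≫ (Rep.standardComplex k G).d (n + 2) (n + 1) +
      (Rep.standardComplex k G).d (n + 1) n ≫ h₀ = 𝟙 _ := by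
    refine Rep.hom_ext (Representation.IntertwiningMap.toLinearMap_injective _ _
      (LinearMap.ext fun z => (standardTermEquiv k G (n + 1)).injective ?_))
    have := hc (standardTermEquiv k G (n + 1) z)
    rw [← standardTermEquiv_standardHom (n + 1) (n + 2) _ (hs _), ← standardTermEquiv_d,
      ← standardTermEquiv_d, ← standardTermEquiv_standardHom n (n + 1) _ (hs _), ← map_add] at this
    exact this
  have key (x : (Rep.standardComplex k G).X (n + 1) ⟶ A)
      (hx : (Rep.standardComplex k G).d (n + 2) (n + 1) ≫ x = 0) :
      (Rep.standardComplex k G).d (n + 1) n ≫ h₀ ≫ x = x := by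
    have := congrArg (· ≫ x) hid
    simpa only [Preadditive.add_comp, Category.assoc, hx, Limits.comp_zero, zero_add,
      Category.id_comp] using this
  refine ModuleCat.subsingleton_of_isZero ?_
  refine Limits.IsZero.of_iso ?_ (groupCohomologyIsoExt A (n + 1) ≪≫
    Rep.standardResolution.extIso k G A (n + 1))
  rw [← HomologicalComplex.exactAt_iff_isZero_homology,
    HomologicalComplex.exactAt_iff' _ n (n + 1) (n + 2) (by simp) (by simp),
    ShortComplex.moduleCat_exact_iff]
  exact fun x hx => ⟨h₀ ≫ x, key x hx⟩

end GroupCohomology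

/-! ### Equivariant neighbourhoods of open cells -/

theorem exists_orbit_representative (G X : Type*) [Group G] [MulAction G X] :
    ∃ r : X → X, (∀ (g : G) x, r (g • x) = r x) ∧ ∀ x, ∃ g : G, g • x = r x := by
  refine ⟨fun x => (Quotient.mk (MulAction.orbitRel G X) x).out, fun g x => ?_, fun x => ?_⟩
  · have h : MulAction.orbitRel G X (g • x) x := MulAction.orbitRel_apply.2 ⟨g, rfl⟩
    exact congrArg Quotient.out (Quotient.sound h)
  · exact (MulAction.orbitRel_apply (G := G)).1 (Quotient.exact (Quotient.out_eq _))

section CellNeighbourhoods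

open Topology.CWComplex Metric

variable {Λ : Type u} [Group Λ] {Y : Type v} [TopologicalSpace Y]
    [Topology.CWComplex (Set.univ : Set Y)]

local notation "cells" => Topology.RelCWComplex.cell (Set.univ : Set Y)

theorem eq_of_mem_openCell {m n : ℕ} {c : cells m} {e : cells n} {y : Y} (hc : y ∈ openCell m c)
    (he : y ∈ openCell n e) : (⟨m, c⟩ : Σ n, cells n) = ⟨n, e⟩ :=
  eq_of_not_disjoint_openCell (Set.not_disjoint_iff.2 ⟨y, hc, he⟩)

theorem cell_eq_of_mem_openCell {n : ℕ} {c e : cells n} {y : Y} (hc : y ∈ openCell n c)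
    (he : y ∈ openCell n e) : c = e := by
  simpa using eq_of_mem_openCell hc he

/-- The complement, in the closed cell `c`, of the radial extension of `U`: the cone, from the
centre of the cell, over the part of its frontier outside `U`. -/
def coneCompl {n : ℕ} (c : cells n) (U : Set Y) : Set Y :=
  insert (map n c 0) ((fun p : ℝ × (Fin n → ℝ) => map n c (p.1 • p.2)) ''
    (Set.Icc 0 1 ×ˢ {x ∈ sphere 0 1 | map n c x ∉ U}))

theorem mem_coneCompl_or_of_disjoint {n : ℕ} {c : cells n} {U U' : Set Y} (hd : Disjoint U U')
    {y : Y} (hy : y ∈ openCell n c) : y ∈ coneCompl c U ∨ y ∈ coneCompl c U' := by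
  obtain ⟨x, hx, rfl⟩ := hy
  rw [mem_ball_zero_iff] at hx
  by_cases h0 : x = 0
  · left; left; rw [h0]
  · have hn : ‖x‖ ≠ 0 := norm_ne_zero_iff.2 h0
    have hs : ‖x‖⁻¹ • x ∈ sphere (0 : Fin n → ℝ) 1 := by
      rw [mem_sphere_zero_iff_norm, norm_smul, norm_inv, norm_norm, inv_mul_cancel₀ hn]
    have hx' : ‖x‖ • (‖x‖⁻¹ • x) = x := by rw [smul_smul, mul_inv_cancel₀ hn, one_smul]
    have key (V : Set Y) (hV : map n c (‖x‖⁻¹ • x) ∉ V) : map n c x ∈ coneCompl c V :=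
      Or.inr ⟨(‖x‖, ‖x‖⁻¹ • x), ⟨⟨norm_nonneg x, hx.le⟩, hs, hV⟩, by
        change map n c (‖x‖ • (‖x‖⁻¹ • x)) = _
        rw [hx']⟩
    by_cases hU : map n c (‖x‖⁻¹ • x) ∈ U
    · exact Or.inr (key U' (Set.disjoint_left.1 hd hU))
    · exact Or.inl (key U hU)

variable [MulAction Λ Y]

/-- The cell onto which a group element carries a cell, under a cellular action. -/
noncomputable def cellSMul (hcell : IsCellularAction Λ Y) (g : Λ) {n : ℕ} (e : cells n) : cells n :=
  (hcell g n e).choose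

theorem image_openCell (hcell : IsCellularAction Λ Y) (g : Λ) {n : ℕ} (e : cells n) :
    (fun y : Y => g • y) '' openCell n e = openCell n (cellSMul hcell g e) :=
  (hcell g n e).choose_spec

theorem smul_mem_openCell (hcell : IsCellularAction Λ Y) (g : Λ) {n : ℕ} {e : cells n} {y : Y}
    (hy : y ∈ openCell n e) : g • y ∈ openCell n (cellSMul hcell g e) := by
  rw [← image_openCell]
  exact ⟨y, hy, rfl⟩

/-- A cellular action permutes the cells of each dimension. -/
noncomputable abbrev cellMulAction (hcell : IsCellularAction Λ Y) (n : ℕ) :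
    MulAction Λ (cells n) where
  smul g e := cellSMul hcell g e
  one_smul e := by
    have := smul_mem_openCell hcell (1 : Λ) (map_zero_mem_openCell n e)
    rw [one_smul] at this
    exact cell_eq_of_mem_openCell this (map_zero_mem_openCell n e)
  mul_smul g h e := by
    have h₁ := smul_mem_openCell hcell (g * h) (map_zero_mem_openCell n e)
    have h₂ := smul_mem_openCell hcell g
      (smul_mem_openCell hcell h (map_zero_mem_openCell n e))
    rw [← mul_smul] at h₂
    exact cell_eq_of_mem_openCell h₁ h₂

theorem cellSMul_mul (hcell : IsCellularAction Λ Y) (g h : Λ) {n : ℕ} (e : cells n) :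
    cellSMul hcell (g * h) e = cellSMul hcell g (cellSMul hcell h e) :=
  (cellMulAction hcell n).mul_smul g h e

theorem cellSMul_injective (hcell : IsCellularAction Λ Y) (g : Λ) {n : ℕ} :
    Function.Injective (cellSMul hcell g : cells n → cells n) :=
  let := cellMulAction hcell n
  MulAction.injective g

theorem cellSMul_inv (hcell : IsCellularAction Λ Y) (g : Λ) {n : ℕ} (e : cells n) :
    cellSMul hcell g⁻¹ (cellSMul hcell g e) = e :=
  let := cellMulAction hcell n
  inv_smul_smul g e

theorem exists_cell_representative (hcell : IsCellularAction Λ Y) (n : ℕ) :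
    ∃ r : cells n → cells n, (∀ g e, r (cellSMul hcell g e) = r e) ∧
      ∀ e, ∃ g, cellSMul hcell g e = r e :=
  letI := cellMulAction hcell n
  exists_orbit_representative Λ (cells n)

variable [T2Space Y] [ContinuousConstSMul Λ Y]

theorem notMem_openCell_of_mem_closedCell {m n : ℕ} (h : m < n) {c : cells m} {e : cells n} {y : Y}
    (hy : y ∈ closedCell m c) : y ∉ openCell n e := by
  have hd := disjoint_skeletonLT_openCell (C := (Set.univ : Set Y)) (n := ((m + 1 : ℕ) : ℕ∞))
    (j := e) (by exact_mod_cast h)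
  exact Set.disjoint_left.1 hd (closedCell_subset_skeletonLT m c hy)

theorem notMem_openCell_of_mem_cellFrontier {n : ℕ} {c e : cells n} {y : Y}
    (hy : y ∈ cellFrontier n c) : y ∉ openCell n e := by
  have hd := disjoint_skeletonLT_openCell (C := (Set.univ : Set Y)) (n := (n : ℕ∞))
    (j := e) le_rfl
  exact Set.disjoint_left.1 hd (cellFrontier_subset_skeletonLT n c hy)

theorem isClosed_coneCompl {n : ℕ} (c : cells n) (U : Set Y)
    (hU : ∀ m < n, ∀ e : cells m, IsClosed (closedCell m e \ U)) : IsClosed (coneCompl c U) := by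
  have hF : IsClosed (cellFrontier n c \ U) := by
    obtain ⟨I, hI⟩ := cellFrontier_subset_finite_closedCell n c
    have : cellFrontier n c \ U =
        cellFrontier n c ∩ ⋃ m ∈ Set.Iio n, ⋃ e ∈ I m, (closedCell m e \ U) := by
      ext y
      simp only [Set.mem_sdiff, Set.mem_inter_iff, Set.mem_iUnion, Set.mem_Iio]
      refine and_congr_right fun hy => ⟨fun h => ?_, ?_⟩
      · obtain ⟨m, hm, e, he, hye⟩ : ∃ m, ∃ (_ : m < n), ∃ e, ∃ (_ : e ∈ I m),
            y ∈ closedCell m e := by simpa using hI hy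
        exact ⟨m, hm, e, he, hye, h⟩
      · rintro ⟨m, hm, e, he, -, h⟩
        exact h
    rw [this]
    refine isClosed_cellFrontier.inter ((Set.finite_Iio n).isClosed_biUnion fun m hm => ?_)
    exact (I m).finite_toSet.isClosed_biUnion fun e _ => hU m hm e
  have hZ : IsCompact {x ∈ sphere (0 : Fin n → ℝ) 1 | map n c x ∉ U} := by
    have hc := ((continuousOn n c).mono sphere_subset_closedBall).preimage_isClosed_of_isClosed
      isClosed_sphere hF
    refine (isCompact_sphere (0 : Fin n → ℝ) 1).of_isClosed_subset ?_ fun x hx => hx.1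
    have he : {x ∈ sphere (0 : Fin n → ℝ) 1 | map n c x ∉ U} =
        sphere 0 1 ∩ map n c ⁻¹' (cellFrontier n c \ U) :=
      Set.ext fun x => ⟨fun h => ⟨h.1, Set.mem_image_of_mem _ h.1, h.2⟩, fun h => ⟨h.1, h.2.2⟩⟩
    rw [he]
    exact hc
  have hK : IsCompact ((fun p : ℝ × (Fin n → ℝ) => map n c (p.1 • p.2)) ''
      (Set.Icc 0 1 ×ˢ {x ∈ sphere 0 1 | map n c x ∉ U})) := by
    refine (isCompact_Icc.prod hZ).image_of_continuousOn ?_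
    refine (continuousOn n c).comp (by fun_prop) ?_
    rintro ⟨s, x⟩ ⟨hs, hx, -⟩
    rw [mem_sphere_zero_iff_norm] at hx
    rw [mem_closedBall_zero_iff, norm_smul, hx, mul_one, Real.norm_of_nonneg hs.1]
    exact hs.2
  exact (hK.insert _).isClosed

theorem mem_coneCompl_iff_of_mem_cellFrontier {n : ℕ} {c : cells n} {U : Set Y} {y : Y}
    (hy : y ∈ cellFrontier n c) : y ∈ coneCompl c U ↔ y ∉ U := by
  have hno := notMem_openCell_of_mem_cellFrontier (e := c) hy
  constructor
  · rintro (rfl | ⟨⟨s, x⟩, ⟨hs, hx, hxU⟩, rfl⟩)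
    · exact absurd (map_zero_mem_openCell n c) hno
    · have hs1 : s = 1 := by
        by_contra hne
        refine hno ⟨s • x, ?_, rfl⟩
        rw [mem_sphere_zero_iff_norm] at hx
        rw [mem_ball_zero_iff, norm_smul, hx, mul_one, Real.norm_of_nonneg hs.1]
        exact lt_of_le_of_ne hs.2 hne
      simpa [hs1] using hxU
  · intro hyU
    obtain ⟨x, hx, rfl⟩ := hy
    exact Or.inr ⟨(1, x), ⟨⟨zero_le_one, le_rfl⟩, hx, hyU⟩, by simp⟩


theorem image_closedCell (hcell : IsCellularAction Λ Y) (g : Λ) {n : ℕ} (e : cells n) :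
    (fun y : Y => g • y) '' closedCell n e = closedCell n (cellSMul hcell g e) := by
  rw [← closure_openCell_eq_closedCell, ← closure_openCell_eq_closedCell, ← image_openCell]
  exact (Homeomorph.smul g).image_closure _

theorem smul_mem_cellFrontier (hcell : IsCellularAction Λ Y) (g : Λ) {n : ℕ} {e : cells n} {y : Y}
    (hy : y ∈ cellFrontier n e) : g • y ∈ cellFrontier n (cellSMul hcell g e) := by
  have hc : g • y ∈ closedCell n (cellSMul hcell g e) := by
    rw [← image_closedCell]
    exact ⟨y, cellFrontier_subset_closedCell n e hy, rfl⟩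
  rw [← cellFrontier_union_openCell_eq_closedCell] at hc
  refine hc.resolve_right fun ho => ?_
  have := smul_mem_openCell hcell g⁻¹ ho
  rw [inv_smul_smul] at this
  exact notMem_openCell_of_mem_cellFrontier hy this

theorem finite_setOf_cellSMul_eq [ProperlyDiscontinuousSMul Λ Y] (hcell : IsCellularAction Λ Y)
    {n : ℕ} (c e : cells n) : {g : Λ | cellSMul hcell g c = e}.Finite := by
  refine (ProperlyDiscontinuousSMul.finite_disjoint_inter_image (Γ := Λ)
    (isCompact_closedCell (C := (Set.univ : Set Y)) (i := c))
    (isCompact_closedCell (C := (Set.univ : Set Y)) (i := e))).subset ?_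
  rintro g rfl
  change ((fun y : Y => g • y) '' _ ∩ _).Nonempty
  rw [image_closedCell hcell, Set.inter_self]
  exact ⟨_, map_zero_mem_closedCell n _⟩

/-- Disjoint equivariant neighbourhoods of the open `j`-cells, open in the skeleton of dimension
`m`, by induction on `m`. A neighbourhood in the `m`-skeleton is extended radially to each
`(m + 1)`-cell. As characteristic maps are not compatible with the action, a point `y` of a cell is
required to be in the radial extension after each of the finitely many translations of the cell to
a chosen representative of its orbit. -/
theorem exists_skeletal_neighbourhoods [ProperlyDiscontinuousSMul Λ Y]
    (hcell : IsCellularAction Λ Y) (j m : ℕ) (hjm : j ≤ m) :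
    ∃ U : cells j → Set Y, (∀ e, openCell j e ⊆ U e) ∧ (∀ e e', e ≠ e' → Disjoint (U e) (U e')) ∧
      (∀ (g : Λ) e y, y ∈ U e → g • y ∈ U (cellSMul hcell g e)) ∧
      ∀ n ≤ m, ∀ (c : cells n) e, IsClosed (closedCell n c \ U e) := by
  induction m, hjm using Nat.le_induction with
  | base =>
    refine ⟨fun e => openCell j e, fun e => subset_rfl, fun e e' h => ?_, fun g e y hy => ?_,
      fun n hn c e => ?_⟩
    · exact Set.disjoint_left.2 fun y hy hy' => h (cell_eq_of_mem_openCell hy hy')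
    · exact smul_mem_openCell hcell g hy
    · rcases hn.lt_or_eq with hn | rfl
      · rw [sdiff_eq_left.2 (Set.disjoint_left.2 fun y hy =>
          notMem_openCell_of_mem_closedCell hn hy)]
        exact isClosed_closedCell
      · by_cases hce : c = e
        · subst hce
          have : closedCell n c \ openCell n c = cellFrontier n c := by
            rw [← cellFrontier_union_openCell_eq_closedCell, Set.union_sdiff_right, sdiff_eq_left]
            exact Set.disjoint_left.2 fun y hy => notMem_openCell_of_mem_cellFrontier hy
          rw [this]
          exact isClosed_cellFrontier
        · rw [sdiff_eq_left.2]
          · exact isClosed_closedCell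
          · refine Set.disjoint_left.2 fun y hy hy' => ?_
            rw [← cellFrontier_union_openCell_eq_closedCell] at hy
            rcases hy with hy | hy
            · exact notMem_openCell_of_mem_cellFrontier hy hy'
            · exact hce (cell_eq_of_mem_openCell hy hy')
  | succ m hjm ih =>
    obtain ⟨U, hsub, hdisj, hequi, hclosed⟩ := ih
    obtain ⟨r, hr, hrex⟩ := exists_cell_representative hcell (m + 1)
    have hequi' (g : Λ) (e) (y) : g • y ∈ U (cellSMul hcell g e) ↔ y ∈ U e := by
      refine ⟨fun h => ?_, hequi g e y⟩
      have := hequi g⁻¹ _ _ h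
      rwa [inv_smul_smul, cellSMul_inv] at this
    let U' : cells j → Set Y := fun e =>
      {y | ((∀ c : cells (m + 1), y ∉ openCell (m + 1) c) ∧ y ∈ U e) ∨
        ∃ c : cells (m + 1), y ∈ openCell (m + 1) c ∧
        ∀ g : Λ, cellSMul hcell g c = r c → g • y ∉ coneCompl (r c) (U (cellSMul hcell g e))}
    -- In the proof that `U' e` is open in an `(m + 1)`-cell `c`, its complement there is a finite
    -- union of translates of the sets `coneCompl`; on the frontier of `c` all of them agree with
    -- the complement of `U e`, by equivariance.
    refine ⟨U', fun e y hy => ?_, fun e e' hee => ?_, fun h e y hy => ?_, fun n hn c e => ?_⟩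
    · exact Or.inl ⟨fun c => notMem_openCell_of_mem_closedCell (by omega)
        (openCell_subset_closedCell _ _ hy), hsub e hy⟩
    · refine Set.disjoint_left.2 ?_
      rintro y (⟨hy, hyU⟩ | ⟨c, hc, hcU⟩) (⟨hy', hyU'⟩ | ⟨c', hc', hcU'⟩)
      · exact Set.disjoint_left.1 (hdisj e e' hee) hyU hyU'
      · exact hy _ hc'
      · exact hy' _ hc
      · obtain rfl := cell_eq_of_mem_openCell hc hc'
        obtain ⟨g, hg⟩ := hrex c
        have hgy := smul_mem_openCell hcell g hc
        rw [hg] at hgy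
        rcases mem_coneCompl_or_of_disjoint
          (hdisj _ _ ((cellSMul_injective hcell g).ne hee)) hgy with h | h
        · exact hcU g hg h
        · exact hcU' g hg h
    · rcases hy with ⟨hy, hyU⟩ | ⟨c, hc, hcU⟩
      · refine Or.inl ⟨fun c hc => ?_, hequi h e y hyU⟩
        have := smul_mem_openCell hcell h⁻¹ hc
        rw [inv_smul_smul] at this
        exact hy _ this
      · refine Or.inr ⟨cellSMul hcell h c, smul_mem_openCell hcell h hc, fun g hg => ?_⟩
        rw [hr, ← cellSMul_mul] at hg
        rw [hr, smul_smul, ← cellSMul_mul]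
        exact hcU _ hg
    · rcases hn.lt_or_eq with hn | rfl
      · have : closedCell n c \ U' e = closedCell n c \ U e := by
          ext y
          refine and_congr_right fun hy => not_congr ?_
          have hno (c' : cells (m + 1)) : y ∉ openCell (m + 1) c' :=
            notMem_openCell_of_mem_closedCell hn hy
          exact ⟨fun h => h.elim (fun h => h.2) fun ⟨c', hc', _⟩ => absurd hc' (hno c'),
            fun h => Or.inl ⟨hno, h⟩⟩
        rw [this]
        exact hclosed n (by omega) c e
      · have : closedCell (m + 1) c \ U' e = closedCell (m + 1) c ∩
            ⋃ g ∈ {g : Λ | cellSMul hcell g c = r c},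
              (fun y : Y => g • y) ⁻¹' coneCompl (r c) (U (cellSMul hcell g e)) := by
          ext y
          refine and_congr_right fun hy => ?_
          simp only [Set.mem_iUnion, Set.mem_ofPred_eq, Set.mem_preimage, exists_prop]
          rw [← cellFrontier_union_openCell_eq_closedCell] at hy
          rcases hy with hy | hy
          · have hno (c' : cells (m + 1)) : y ∉ openCell (m + 1) c' :=
              notMem_openCell_of_mem_cellFrontier hy
            have hU' : y ∈ U' e ↔ y ∈ U e :=
              ⟨fun h => h.elim (fun h => h.2) fun ⟨c', hc', _⟩ => absurd hc' (hno c'),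
                fun h => Or.inl ⟨hno, h⟩⟩
            have hiff (g : Λ) (hg : cellSMul hcell g c = r c) :
                g • y ∈ coneCompl (r c) (U (cellSMul hcell g e)) ↔ y ∉ U e := by
              have hgy := smul_mem_cellFrontier hcell g hy
              rw [hg] at hgy
              rw [mem_coneCompl_iff_of_mem_cellFrontier hgy, hequi']
            rw [hU']
            constructor
            · intro h
              obtain ⟨g, hg⟩ := hrex c
              exact ⟨g, hg, (hiff g hg).2 h⟩
            · rintro ⟨g, hg, h⟩
              exact (hiff g hg).1 h
          · have hU' : y ∈ U' e ↔ ∀ g : Λ, cellSMul hcell g c = r c →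
                g • y ∉ coneCompl (r c) (U (cellSMul hcell g e)) := by
              constructor
              · rintro (⟨h, -⟩ | ⟨c', hc', h⟩)
                · exact absurd hy (h c)
                · obtain rfl := cell_eq_of_mem_openCell hy hc'
                  exact h
              · exact fun h => Or.inr ⟨c, hy, h⟩
            rw [hU']
            push Not
            rfl
        rw [this]
        refine isClosed_closedCell.inter
          ((finite_setOf_cellSMul_eq hcell c (r c)).isClosed_biUnion fun g _ => ?_)
        exact (isClosed_coneCompl _ _ fun n hn c' => hclosed n (by omega) c' _).preimage
          (continuous_const_smul g)

end CellNeighbourhoods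

/-! ### Averages over finite stabilizers -/

section Averaging

open TupleChain

/-- Averaging over finite stabilizers: an equivariant map from a `Λ`-set to `k[Λ]`, of augmentation
`1` at the points with finite stabilizer. The point `x` is sent to the average of the elements
which carry a chosen representative of its orbit to `x`. -/
theorem exists_equivariant_average (k : Type*) [CommRing k] [Algebra ℚ k] (Λ X : Type*) [Group Λ]
    [MulAction Λ X] :
    ∃ v : X → Λ →₀ k, (∀ x, {g : Λ | g • x = x}.Finite → aug (v x) = 1) ∧
      ∀ (g : Λ) x, v (g • x) = Finsupp.mapDomain (fun h => g * h) (v x) := by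
  classical
  obtain ⟨r, hr, hrex'⟩ := exists_orbit_representative Λ X
  have hrex (x : X) : ∃ g : Λ, g • r x = x := by
    obtain ⟨g, hg⟩ := hrex' x
    exact ⟨g⁻¹, inv_smul_eq_iff.2 hg.symm⟩
  let T : X → Set Λ := fun x => {g | g • r x = x}
  have hT (g : Λ) (x : X) : T (g • x) = (fun h => g * h) '' T x := by
    ext h
    simp only [T, hr, Set.mem_ofPred_eq, Set.mem_image]
    constructor
    · intro hh
      exact ⟨g⁻¹ * h, by rw [mul_smul, hh, inv_smul_smul], by simp⟩
    · rintro ⟨h', hh', rfl⟩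
      rw [mul_smul, hh']
  let v : X → Λ →₀ k := fun x => if h : (T x).Finite then
    algebraMap ℚ k (h.toFinset.card : ℚ)⁻¹ • ∑ g ∈ h.toFinset, Finsupp.single g 1 else 0
  refine ⟨v, fun x hx => ?_, fun g x => ?_⟩
  · obtain ⟨g₀, hg₀⟩ := hrex x
    have hfin : (T x).Finite := by
      refine (hx.image fun g => g * g₀).subset fun g hg => ⟨g * g₀⁻¹, ?_, by simp⟩
      change (g * g₀⁻¹) • x = x
      rw [mul_smul, inv_smul_eq_iff.2 hg₀.symm]
      exact hg
    have hcard : (hfin.toFinset.card : ℚ) ≠ 0 := by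
      rw [Nat.cast_ne_zero]
      exact Finset.card_ne_zero_of_mem (hfin.mem_toFinset.2 hg₀)
    simp only [v, dif_pos hfin, map_smul, map_sum, aug, Finsupp.linearCombination_single,
      Finset.sum_const, nsmul_eq_mul, mul_one, smul_eq_mul]
    rw [← map_natCast (algebraMap ℚ k), ← map_mul, inv_mul_cancel₀ hcard, map_one]
  · by_cases hfin : (T x).Finite
    · have hfin' : (T (g • x)).Finite := by rw [hT]; exact hfin.image _
      have him : hfin'.toFinset = hfin.toFinset.image fun h => g * h := by
        ext h
        simp [hT]
      simp only [v, dif_pos hfin, dif_pos hfin']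
      rw [him, Finset.card_image_of_injective _ (mul_right_injective g),
        Finset.sum_image (mul_right_injective g).injOn, Finsupp.mapDomain_smul,
        Finsupp.mapDomain_finsetSum]
      simp only [Finsupp.mapDomain_single]
    · have hfin' : ¬ (T (g • x)).Finite := by
        rw [hT]
        exact fun h => hfin (h.of_finite_image (mul_right_injective g).injOn)
      simp only [v, dif_neg hfin, dif_neg hfin', Finsupp.mapDomain_zero]

end Averaging

/-! ### Equivariant functions constant near open cells -/

section DimensionBound

open Topology.CWComplex TupleChain
open scoped Pointwise

variable {Λ : Type u} [Group Λ] {Y : Type v} [TopologicalSpace Y] [T2Space Y]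
    [Topology.CWComplex (Set.univ : Set Y)] [MulAction Λ Y] [ContinuousConstSMul Λ Y]
    [ProperlyDiscontinuousSMul Λ Y]

local notation "cells" => Topology.RelCWComplex.cell (Set.univ : Set Y)

theorem exists_equivariant_neighbourhoods (hcell : IsCellularAction Λ Y) (d : ℕ)
    (hd : ∀ n, Nonempty (cells n) → n ≤ d) (j : ℕ) :
    ∃ U : cells j → Set Y, (∀ e, openCell j e ⊆ U e) ∧ (∀ e e', e ≠ e' → Disjoint (U e) (U e')) ∧
      (∀ (g : Λ) e y, y ∈ U e → g • y ∈ U (cellSMul hcell g e)) ∧ ∀ e, IsOpen (U e) := by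
  obtain ⟨U, h₁, h₂, h₃, h₄⟩ := exists_skeletal_neighbourhoods hcell j (max j d) (le_max_left _ _)
  refine ⟨U, h₁, h₂, h₃, fun e => ?_⟩
  rw [← isClosed_compl_iff, closed (Set.univ : Set Y) _ (Set.subset_univ _)]
  intro n c
  rw [Set.inter_comm]
  exact h₄ n ((hd n ⟨c⟩).trans (le_max_right _ _)) c e

/-- Equivariant neighbourhoods of the open `j`-cells give an equivariant map to `k[Λ]`, constant on
each of them. -/
theorem exists_equivariant_function (k : Type*) [CommRing k] [Algebra ℚ k]
    (hcell : IsCellularAction Λ Y) (j : ℕ) (U : cells j → Set Y)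
    (hdisj : ∀ e e', e ≠ e' → Disjoint (U e) (U e'))
    (hequi : ∀ (g : Λ) e y, y ∈ U e → g • y ∈ U (cellSMul hcell g e)) :
    ∃ p : Y → Λ →₀ k, (∀ y, aug (p y) = 1) ∧
      (∀ (g : Λ) y, p (g • y) = Finsupp.mapDomain (fun h => g * h) (p y)) ∧
      ∀ e, ∀ y ∈ U e, ∀ y' ∈ U e, p y = p y' := by
  classical
  obtain ⟨v, hv, hve⟩ := exists_equivariant_average k Λ (Set Y)
  -- `p` is read off from the translates of open cells and of points, as elements of the `Λ`-set of
  -- subsets of `Y`.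
  let S : Y → Set Y := fun y => if h : ∃ e, y ∈ U e then openCell j h.choose else {y}
  have hS (e : cells j) (y : Y) (hy : y ∈ U e) : S y = openCell j e := by
    have h : ∃ e, y ∈ U e := ⟨e, hy⟩
    simp only [S, dif_pos h]
    congr 1
    by_contra hne
    exact Set.disjoint_left.1 (hdisj _ _ hne) h.choose_spec hy
  have hS' (y : Y) (h : ¬ ∃ e, y ∈ U e) : S y = {y} := by simp only [S, dif_neg h]
  refine ⟨fun y => v (S y), fun y => hv _ ?_, fun g y => ?_, fun e y hy y' hy' => ?_⟩
  · by_cases h : ∃ e, y ∈ U e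
    · obtain ⟨e, he⟩ := h
      rw [hS e y he]
      refine (finite_setOf_cellSMul_eq hcell e e).subset fun g hg => ?_
      refine Topology.RelCWComplex.openCell_congr j ?_
      rw [← image_openCell]
      exact hg
    · rw [hS' y h]
      refine (ProperlyDiscontinuousSMul.finite_stabilizer' Λ y).subset fun g hg => ?_
      simpa using hg
  · change v (S (g • y)) = _
    rw [← hve]
    congr 1
    by_cases h : ∃ e, y ∈ U e
    · obtain ⟨e, he⟩ := h
      rw [hS e y he, hS _ _ (hequi g e y he), ← image_openCell]
      rfl
    · rw [hS' y h, hS', Set.smul_set_singleton]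
      rintro ⟨e, he⟩
      have := hequi g⁻¹ _ _ he
      rw [inv_smul_smul] at this
      exact h ⟨_, this⟩
  · change v (S y) = v (S y')
    rw [hS e y hy, hS e y' hy']

end DimensionBound

/-! ### The dimension bound -/

theorem mainTheorem6 (Λ : Type u) [Group Λ] (Y : Type v) [TopologicalSpace Y] [T2Space Y]
    [Topology.CWComplex (Set.univ : Set Y)] [ContractibleSpace Y]
    [MulAction Λ Y] [ContinuousConstSMul Λ Y] [ProperlyDiscontinuousSMul Λ Y]
    (hcell : IsCellularAction Λ Y) :
    rationalCohomologicalDimension Λ ≤ cwDimension Y := by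
  by_cases htop : cwDimension Y = ⊤
  · rw [htop]; exact le_top
  obtain ⟨d, hd⟩ := ENat.ne_top_iff_exists.1 htop
  have hdim (n : ℕ) (hn : Nonempty (Topology.CWComplex.cell (Set.univ : Set Y) n)) : n ≤ d := by
    have : (n : ℕ∞) ≤ cwDimension Y := le_iSup₂_of_le (f := fun (n : ℕ) _ => (n : ℕ∞)) n hn le_rfl
    rw [← hd] at this
    exact_mod_cast this
  choose U hsub hdisj hequi hopen using exists_equivariant_neighbourhoods hcell d hdim
  choose p haug hp hconst using fun j =>
    exists_equivariant_function (ULift.{u} ℚ) hcell j (U j) (hdisj j) (hequi j)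
  -- The cover consists of the neighbourhoods of all open cells; `p j` is constant on those of
  -- `j`-cells.
  obtain ⟨s, hs, hcontr⟩ := TupleChain.exists_equivariant_contraction (k := ULift.{u} ℚ)
    {V : Set Y | ∃ j, j ≤ d ∧ ∃ e, V = U j e}
    (by rintro _ ⟨j, -, e, rfl⟩; exact hopen j e)
    (by
      refine Set.eq_univ_of_forall fun y => ?_
      obtain ⟨n, e, he⟩ : ∃ n, ∃ e : Topology.RelCWComplex.cell (Set.univ : Set Y) n,
          y ∈ Topology.RelCWComplex.openCell n e := by
        have hy := Set.mem_univ y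
        rw [← Topology.CWComplex.iUnion_openCell_eq_complex (C := (Set.univ : Set Y))] at hy
        simpa using hy
      exact ⟨U n e, ⟨n, hdim n ⟨e⟩, e, rfl⟩, hsub n e he⟩)
    (by
      rintro g _ ⟨j, hj, e, rfl⟩
      exact ⟨_, ⟨j, hj, _, rfl⟩, hequi j g e⟩)
    p haug hp d
    (by
      rintro _ ⟨j, hj, e, rfl⟩
      exact ⟨j, hj, hconst j e⟩)
  rw [← hd]
  refine iSup₂_le fun n hn => ?_
  obtain ⟨A, hA⟩ := hn
  by_contra hlt
  rw [not_le, Nat.cast_lt] at hlt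
  obtain ⟨m, rfl⟩ : ∃ m, n = m + 1 := ⟨n - 1, by omega⟩
  have := subsingleton_groupCohomology_of_contraction s hs m (hcontr (m + 1) (by omega)) A
  exact not_nontrivial _ hA
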